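/- **Corollary (combinatorial reciprocity for $A_\mu$ on hooks).** For a partition $\mu$ and $h\ge 0$, let $s_\mu[s_h](q^{-1},q)=s_\mu(q^{-h},q^{-h+2},\dots,q^{h})$ be the plethysm of the Schur function $s_\mu$ with $s_h$, evaluated at the two variables $q^{-1},q$. For $k\ge 1$ let $a_{\mu[h]}^{[k]}\in\mathbb Z$ be the coefficient of the $q$-integer $[k]_q=\frac{q^k-q^{-k}}{q-q^{-1}}$ in the (unique, finite) expansion $s_\mu[s_h](q^{-1},q)=\sum_{k\ge 1}a_{\mu[h]}^{[k]}\,[k]_q$, and put $$A_\mu(z,q)=\sum_{h\ge 0}\sum_{k\ge 1}a_{\mu[h]}^{[k]}\,q^kz^h\in\mathbb Z[q][[z]].$$ Let $\mu=(n+1,1^m)$ be a hook with $n,m\ge 0$ and $(n,m)\neq(0,0)$, and let $w=|\mu|=n+m+1$. Then every $s_\mu[s_h](q^{-1},q)$ has such an expansion, $A_\mu(z,q)$ is (the expansion of) a unique rational function in $z$ and $q$, and this rational function satisfies $$A_\mu(z^{-1},q^{-1})=(-1)^w\,z^{\,n-m+2}\,A_\mu(z,q).$$ -/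

import Mathlib

open Polynomial

namespace SL2Plethysm

noncomputable section

/-! ## Schur polynomials -/

/-- Semistandard Young tableaux of shape `μ` over the alphabet `{0, 1, …, N - 1}`. -/
abbrev BoundedSSYT (μ : YoungDiagram) (N : ℕ) : Type :=
  {T : SemistandardYoungTableau μ // ∀ c ∈ μ.cells, T c.1 c.2 < N}

instance (μ : YoungDiagram) (N : ℕ) : Finite (BoundedSSYT μ N) := by
  refine Finite.of_injective
    (fun (T : BoundedSSYT μ N) (c : μ.cells) => (⟨T.1 c.1.1 c.1.2, T.2 c.1 c.2⟩ : Fin N)) ?_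
  intro T T' h
  apply Subtype.ext
  ext i j
  by_cases hc : (i, j) ∈ μ
  · have := congrFun h ⟨(i, j), hc⟩
    simpa using this
  · rw [T.1.zeros hc, T'.1.zeros hc]

instance (μ : YoungDiagram) (N : ℕ) : Fintype (BoundedSSYT μ N) := Fintype.ofFinite _

/-- The value `s_μ(x_0, …, x_{N-1})` of the Schur polynomial: the sum over semistandard tableaux
`T` of shape `μ` over the alphabet `{0, …, N - 1}` of the monomials `x^{wt(T)}`. -/
def schur {R : Type*} [CommSemiring R] (μ : YoungDiagram) {N : ℕ} (x : Fin N → R) : R :=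
  ∑ T : BoundedSSYT μ N, ∏ c : μ.cells, x ⟨T.1 c.1.1 c.1.2, T.2 c.1 c.2⟩

/-! ## Plethysm with `s_h` and `SL₂`-plethysm coefficients -/

/-- The partition `(h)`. -/
def rowDiagram (h : ℕ) : YoungDiagram :=
  YoungDiagram.ofRowLens [h] (List.pairwise_singleton _ _).sortedGE

/-- The `h + 1` monomials `q^{-h}, q^{-h+2}, …, q^h` whose sum is `s_h(q^{-1}, q)`;
see `sum_monomials`. -/
def monomials (h : ℕ) (i : Fin (h + 1)) : LaurentPolynomial ℤ :=
  LaurentPolynomial.T (2 * (i : ℤ) - h)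

theorem mem_rowDiagram {h i j : ℕ} : (i, j) ∈ rowDiagram h ↔ i = 0 ∧ j < h := by
  rw [rowDiagram, YoungDiagram.mem_ofRowLens]
  constructor
  · rintro ⟨h1, h2⟩
    obtain rfl : i = 0 := by simpa using h1
    exact ⟨rfl, by simpa using h2⟩
  · rintro ⟨rfl, hj⟩
    exact ⟨by simp, by simpa using hj⟩

/-- The tableau `0 ⋯ 0 1 ⋯ 1` of shape `(h)` whose last `i` entries are `1`. -/
def rowTableau (h : ℕ) (i : Fin (h + 1)) : BoundedSSYT (rowDiagram h) 2 :=
  ⟨{ entry := fun r j => if r = 0 ∧ j < h ∧ h ≤ j + i then 1 else 0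
     row_weak' := by
       intro r j1 j2 hj hc
       have := mem_rowDiagram.1 hc
       split_ifs <;> omega
     col_strict' := by
       intro i1 i2 j hi hc
       have := mem_rowDiagram.1 hc
       omega
     zeros' := by
       intro r j hc
       rw [mem_rowDiagram] at hc
       rw [if_neg]
       tauto }, by
    intro c _
    change (if _ then 1 else 0) < 2
    split_ifs <;> omega⟩

theorem rowTableau_apply (h : ℕ) (i : Fin (h + 1)) (r j : ℕ) :
    (rowTableau h i).1 r j = if r = 0 ∧ j < h ∧ h ≤ j + i then 1 else 0 := rfl

theorem rowTableau_bijective (h : ℕ) : Function.Bijective (rowTableau h) := by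
  constructor
  · intro a b hab
    have hE : ∀ j, (rowTableau h a).1 0 j = (rowTableau h b).1 0 j := fun j => by rw [hab]
    simp only [rowTableau_apply] at hE
    have ha := a.2
    have hb := b.2
    ext
    by_contra hne
    rcases Nat.lt_or_gt_of_ne hne with hlt | hlt
    · have := hE (h - b)
      rw [if_neg (by omega), if_pos ⟨trivial, by omega, by omega⟩] at this
      omega
    · have := hE (h - a)
      rw [if_pos ⟨trivial, by omega, by omega⟩, if_neg (by omega)] at this
      omega
  · intro T
    classical
    have hex : ∃ s, T.1 0 s = 1 ∨ h ≤ s := ⟨h, Or.inr le_rfl⟩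
    have hle : Nat.find hex ≤ h := Nat.find_min' hex (Or.inr le_rfl)
    refine ⟨⟨h - Nat.find hex, by omega⟩, ?_⟩
    apply Subtype.ext
    ext r j
    rw [rowTableau_apply]
    by_cases hc : (r, j) ∈ rowDiagram h
    · obtain ⟨rfl, hj⟩ := mem_rowDiagram.1 hc
      have hlt : T.1 0 j < 2 := T.2 (0, j) hc
      split_ifs with hif
      · have hsj : Nat.find hex ≤ j := by have := hif.2.2; simp only at this; omega
        have hs : T.1 0 (Nat.find hex) = 1 := by
          rcases Nat.find_spec hex with h1 | h1
          · exact h1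
          · omega
        have := T.1.row_weak_of_le hsj hc
        omega
      · have hjs : j < Nat.find hex := by
          by_contra hcon
          exact hif ⟨rfl, hj, by simp only; omega⟩
        have := Nat.find_min hex hjs
        omega
    · rw [T.1.zeros hc, if_neg]
      rw [mem_rowDiagram] at hc
      tauto

/-- `monomials h` lists the monomials of `s_h(q^{-1}, q)`. -/
theorem sum_monomials (h : ℕ) :
    schur (rowDiagram h) ![LaurentPolynomial.T (-1), LaurentPolynomial.T 1] =
      ∑ i, monomials h i := by
  rw [schur]
  symm
  refine Fintype.sum_bijective _ (rowTableau_bijective h) _ _ fun i => ?_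
  have hx : ∀ v : Fin 2, (![LaurentPolynomial.T (-1), LaurentPolynomial.T 1] v :
      LaurentPolynomial ℤ) = LaurentPolynomial.T (2 * (v : ℤ) - 1) := by
    intro v
    fin_cases v <;> simp
  simp only [hx]
  rw [Finset.prod_coe_sort (rowDiagram h).cells
    (fun c => (LaurentPolynomial.T (2 * (((rowTableau h i).1 c.1 c.2 : ℕ) : ℤ) - 1) :
      LaurentPolynomial ℤ))]
  have hcells : (rowDiagram h).cells =
      (Finset.range h).image (fun j => ((0, j) : ℕ × ℕ)) := by
    ext ⟨r, j⟩
    rw [YoungDiagram.mem_cells, mem_rowDiagram]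
    simp only [Finset.mem_image, Finset.mem_range, Prod.mk.injEq]
    constructor
    · rintro ⟨rfl, hj⟩
      exact ⟨j, hj, rfl, rfl⟩
    · rintro ⟨a, ha, rfl, rfl⟩
      exact ⟨rfl, ha⟩
  simp only [rowTableau_apply]
  rw [hcells, Finset.prod_image (fun a _ b _ hab => by simpa using hab)]
  simp only [true_and]
  have hT : ∀ n, (∏ j ∈ Finset.range n, (LaurentPolynomial.T
      (2 * ((if j < h ∧ h ≤ j + (i : ℕ) then 1 else 0 : ℕ) : ℤ) - 1) : LaurentPolynomial ℤ)) =
      LaurentPolynomial.T (∑ j ∈ Finset.range n,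
        (2 * ((if j < h ∧ h ≤ j + (i : ℕ) then 1 else 0 : ℕ) : ℤ) - 1)) := by
    intro n
    induction n with
    | zero => simp
    | succ n ih => rw [Finset.prod_range_succ, Finset.sum_range_succ, ih, LaurentPolynomial.T_add]
  rw [hT, monomials]
  congr 1
  have hS : ∀ n, n ≤ h → ∑ j ∈ Finset.range n,
      (2 * ((if j < h ∧ h ≤ j + (i : ℕ) then 1 else 0 : ℕ) : ℤ) - 1) =
      2 * ((n + i - h : ℕ) : ℤ) - n := by
    intro n
    have := i.2
    induction n with
    | zero => intro _; simp; omega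
    | succ n ih =>
      intro hn
      rw [Finset.sum_range_succ, ih (by omega)]
      split_ifs <;> push_cast <;> omega
  rw [hS h le_rfl]
  simp

/-- The plethysm `s_μ[s_h](q^{-1}, q)`. As `s_h(q^{-1}, q)` is a sum of monomials (each with
coefficient one), its plethysm with `s_μ` is obtained by substituting these monomials for the
variables of `s_μ`. -/
def plethysm (μ : YoungDiagram) (h : ℕ) : LaurentPolynomial ℤ :=
  schur μ (monomials h)

/-- The `q`-integer `[k]_q = (q^k - q^{-k}) / (q - q^{-1}) = q^{k-1} + q^{k-3} + ⋯ + q^{1-k}`;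
see `qInt_spec`. -/
def qInt (k : ℕ) : LaurentPolynomial ℤ :=
  ∑ j ∈ Finset.range k, LaurentPolynomial.T ((k : ℤ) - 1 - 2 * j)

theorem qInt_spec (k : ℕ) :
    (LaurentPolynomial.T 1 - LaurentPolynomial.T (-1)) * qInt k =
      (LaurentPolynomial.T k - LaurentPolynomial.T (-k) : LaurentPolynomial ℤ) := by
  have key : ∀ n : ℕ, ∑ j ∈ Finset.range n,
      ((LaurentPolynomial.T ((k : ℤ) - 2 * j) : LaurentPolynomial ℤ) -
        LaurentPolynomial.T ((k : ℤ) - 2 * (j + 1 : ℕ))) =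
      LaurentPolynomial.T ((k : ℤ) - 2 * (0 : ℕ)) - LaurentPolynomial.T ((k : ℤ) - 2 * n) :=
    fun n => Finset.sum_range_sub'
      (fun j : ℕ => (LaurentPolynomial.T ((k : ℤ) - 2 * j) : LaurentPolynomial ℤ)) n
  rw [qInt, Finset.mul_sum]
  have hk := key k
  rw [show (k : ℤ) - 2 * (0 : ℕ) = k by simp, show (k : ℤ) - 2 * k = -k by ring] at hk
  rw [← hk]
  refine Finset.sum_congr rfl fun j _ => ?_
  rw [sub_mul, ← LaurentPolynomial.T_add, ← LaurentPolynomial.T_add]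
  congr 2
  · ring
  · push_cast; ring

/-- `f = ∑_{k ≥ 1} a_k [k]_q`, a finite sum, with the convention `a_0 = 0`. -/
def IsQIntExpansion (f : LaurentPolynomial ℤ) (a : ℕ →₀ ℤ) : Prop :=
  a 0 = 0 ∧ f = a.sum fun k c => c • qInt k

/-- Such an expansion is unique. -/
theorem IsQIntExpansion.unique {f : LaurentPolynomial ℤ} {a b : ℕ →₀ ℤ}
    (ha : IsQIntExpansion f a) (hb : IsQIntExpansion f b) : a = b := by
  have coeff : ∀ {a : ℕ →₀ ℤ}, IsQIntExpansion f a → ∀ n : ℕ, 0 < n →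
      a n = ((LaurentPolynomial.T 1 - LaurentPolynomial.T (-1)) * f).coeff (n : ℤ) := by
    intro a ha n hn
    rw [ha.2, Finsupp.sum, Finset.mul_sum, AddMonoidAlgebra.coeff_sum, Finsupp.finsetSum_apply]
    have hterm : ∀ k ∈ a.support,
        ((LaurentPolynomial.T 1 - LaurentPolynomial.T (-1)) * a k • qInt k).coeff (n : ℤ) =
          if k = n then a k else 0 := by
      intro k _
      have hkn : (-(k : ℤ)) ≠ n := by omega
      rw [mul_smul_comm, qInt_spec, AddMonoidAlgebra.coeff_smul, Finsupp.smul_apply,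
        AddMonoidAlgebra.coeff_sub, Finsupp.sub_apply, LaurentPolynomial.T_apply,
        LaurentPolynomial.T_apply, if_neg hkn]
      simp
    rw [Finset.sum_congr rfl hterm, Finset.sum_ite_eq']
    split_ifs with h
    · rfl
    · simpa using h
  ext n
  rcases Nat.eq_zero_or_pos n with rfl | hn
  · rw [ha.1, hb.1]
  · rw [coeff ha n hn, coeff hb n hn]

open Classical in
/-- The family of coefficients of `[k]_q`, `k ≥ 1`, in the expansion of `f`
(zero if there is no expansion). -/
def qIntCoeff (f : LaurentPolynomial ℤ) : ℕ →₀ ℤ :=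
  if h : ∃ a, IsQIntExpansion f a then h.choose else 0

theorem IsQIntExpansion.qIntCoeff_eq {f : LaurentPolynomial ℤ} {a : ℕ →₀ ℤ}
    (ha : IsQIntExpansion f a) : qIntCoeff f = a := by
  have h : ∃ a, IsQIntExpansion f a := ⟨a, ha⟩
  rw [qIntCoeff, dif_pos h]
  exact h.choose_spec.unique ha

/-- The `SL₂`-plethysm coefficient `a_{μ[h]}^{[k]}`: the coefficient of `[k]_q` in
`s_μ[s_h](q^{-1}, q)`. -/
def plethysmCoeff (μ : YoungDiagram) (h k : ℕ) : ℤ :=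
  qIntCoeff (plethysm μ h) k

/-- The generating function `A_μ(z, q) = ∑_{h ≥ 0} ∑_{k ≥ 1} a_{μ[h]}^{[k]} q^k z^h`, a power series
in `z` whose coefficients are polynomials in `q`. -/
def A (μ : YoungDiagram) : PowerSeries ℤ[X] :=
  PowerSeries.mk fun h =>
    ∑ k ∈ (qIntCoeff (plethysm μ h)).support, Polynomial.monomial k (plethysmCoeff μ h k)

/-! ## Rational functions in `z` and `q` -/

/-- The field `ℚ(q, z)` of rational functions, as the field of fractions of `ℤ[q][z]`. -/
abbrev RatFun : Type := FractionRing ℤ[X][X]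

/-- The rational function `q`. -/
def qVar : RatFun := algebraMap ℤ[X][X] RatFun (C X)

/-- The rational function `z`. -/
def zVar : RatFun := algebraMap ℤ[X][X] RatFun X

/-- The rational function `r` is the power series `F`: writing `r = P / D` with polynomials `P` and
`D ≠ 0` one has `D F = P`. -/
def Represents (r : RatFun) (F : PowerSeries ℤ[X]) : Prop :=
  ∃ P D : ℤ[X][X], D ≠ 0 ∧ (D : PowerSeries ℤ[X]) * F = (P : PowerSeries ℤ[X]) ∧
    r = algebraMap ℤ[X][X] RatFun P / algebraMap ℤ[X][X] RatFun D

/-- The substitution `P(z, q) ↦ P(z⁻¹, q⁻¹)` on polynomials. -/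
def invVarsPoly : ℤ[X][X] →+* RatFun :=
  eval₂RingHom (eval₂RingHom (Int.castRingHom RatFun) qVar⁻¹) zVar⁻¹

theorem invVarsPoly_injective : Function.Injective invVarsPoly := by
  have hinj : Function.Injective (algebraMap ℤ[X][X] RatFun) := IsFractionRing.injective _ _
  have hq : qVar ≠ 0 := by
    rw [qVar, Ne, map_eq_zero_iff _ hinj, C_eq_zero]
    exact X_ne_zero
  have hz : zVar ≠ 0 := by
    rw [zVar, Ne, map_eq_zero_iff _ hinj]
    exact X_ne_zero
  let := invertibleOfNonzero hq
  let := invertibleOfNonzero hz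
  have hqC : ∀ c : ℤ[X], eval₂ (Int.castRingHom RatFun) qVar c = algebraMap ℤ[X][X] RatFun (C c) := by
    intro c
    have : (eval₂RingHom (Int.castRingHom RatFun) qVar) =
        (algebraMap ℤ[X][X] RatFun).comp (C : ℤ[X] →+* ℤ[X][X]) := by
      apply Polynomial.ringHom_ext
      · intro a; simp
      · simp [qVar]
    exact RingHom.congr_fun this c
  rw [injective_iff_map_eq_zero]
  intro p hp
  -- clear the negative powers of `z`
  have hp' : eval₂ (eval₂RingHom (Int.castRingHom RatFun) qVar⁻¹) zVar (reverse p) = 0 := by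
    have h := eval₂_reverse_eq_zero_iff
      (eval₂RingHom (Int.castRingHom RatFun) qVar⁻¹) zVar (reverse p)
    have h2 := eval₂_reflect_mul_pow
      (eval₂RingHom (Int.castRingHom RatFun) qVar⁻¹) zVar p.natDegree (reflect p.natDegree p)
      (natDegree_reflect_le.trans (by simp))
    rw [reflect_reflect, invOf_eq_inv] at h2
    rw [reverse, ← h2]
    have hp0 : eval₂ (eval₂RingHom (Int.castRingHom RatFun) qVar⁻¹) zVar⁻¹ p = 0 := hp
    rw [hp0, zero_mul]
  -- clear the negative powers of `q`
  set g := reverse p with hg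
  let N := g.support.sup fun i => (g.coeff i).natDegree
  let G : ℤ[X][X] := ∑ i ∈ g.support, Polynomial.monomial i (reflect N (g.coeff i))
  have hG : algebraMap ℤ[X][X] RatFun G = 0 := by
    have hterm : ∀ i ∈ g.support,
        algebraMap ℤ[X][X] RatFun (Polynomial.monomial i (reflect N (g.coeff i))) =
        (eval₂ (Int.castRingHom RatFun) qVar⁻¹ (g.coeff i) * zVar ^ i) * qVar ^ N := by
      intro i hi
      have hN : (g.coeff i).natDegree ≤ N :=
        Finset.le_sup (f := fun i => (g.coeff i).natDegree) hi
      have h2 := eval₂_reflect_mul_pow (Int.castRingHom RatFun) qVar N (reflect N (g.coeff i))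
        (natDegree_reflect_le.trans (by simpa using hN))
      rw [reflect_reflect, invOf_eq_inv, hqC] at h2
      rw [mul_right_comm, h2, ← C_mul_X_pow_eq_monomial, map_mul, map_pow, zVar]
    rw [map_sum, Finset.sum_congr rfl hterm, ← Finset.sum_mul]
    rw [eval₂_eq_sum, Polynomial.sum] at hp'
    have : ∑ i ∈ g.support, eval₂ (Int.castRingHom RatFun) qVar⁻¹ (g.coeff i) * zVar ^ i = 0 := hp'
    rw [this, zero_mul]
  have hG0 : G = 0 := (map_eq_zero_iff _ hinj).1 hG
  have hg0 : g = 0 := by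
    ext1 i
    by_contra hi
    have hmem : i ∈ g.support := by simpa [mem_support_iff] using hi
    have hc : G.coeff i = reflect N (g.coeff i) := by
      simp only [G, finsetSum_coeff, coeff_monomial]
      rw [Finset.sum_ite_eq', if_pos hmem]
    rw [hG0, coeff_zero] at hc
    exact hi (by simpa using hc.symm)
  exact reverse_eq_zero.1 hg0

theorem invVarsPoly_ne_zero {p : ℤ[X][X]} (hp : p ≠ 0) : invVarsPoly p ≠ 0 :=
  (map_ne_zero_iff _ invVarsPoly_injective).2 hp

/-- The substitution `r(z, q) ↦ r(z⁻¹, q⁻¹)` on rational functions. -/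
def invVars : RatFun →+* RatFun :=
  IsFractionRing.lift invVarsPoly_injective

/-! ## Hooks -/

/-- The hook partition `(n + 1, 1^m)`. -/
def hook (n m : ℕ) : YoungDiagram :=
  YoungDiagram.ofRowLens ((n + 1) :: List.replicate m 1) <| List.Pairwise.sortedGE <|
    List.pairwise_cons.2 ⟨fun a ha => by
      rw [List.eq_of_mem_replicate ha]; exact Nat.le_add_left 1 n,
      List.pairwise_replicate.2 (Or.inr le_rfl)⟩

end

end SL2Plethysm

open SL2Plethysm

/-!
Write `w = n + m + 1`. Splitting off the hook tableaux with a given smallest entry gives the product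
formula `s_μ[s_h](q⁻¹, q) = qBinom w (h - m) * qBinom n m` (zero for `h < m`), so the `q`-binomial theorem
yields
`∑_h s_μ[s_h](q⁻¹, q) z^h = qBinom n m z^m / ∏_{j = 0}^w (1 - z q^{w - 2 j})`.
Since `(q - q⁻¹) [k]_q = q^k - q^{-k}`, the series `A(z, q) - A(z, q⁻¹)` is `q - q⁻¹` times this
(`prod_mul_laurentA_sub`), and `A(z, q)` is its part of positive degree in `q`.

The denominator is `(1 - z)^ε U V` up to a power of `q`. Here `U = ∏ (1 - z q^a)` and `V = ∏ (q^a - z)`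
run over the positive exponents `a = w - 2 j`, and `ε` is `1` or `0` according to whether `w` is even or
odd. As `U` and `V` are coprime in `q`, there is a partial fraction decomposition into `τ / U` and `σ / V`.
In the expansion in powers of `z` the first has only nonnegative and the second only negative powers
of `q`, so the first gives `A(z, q)` (`toSeries_mul_A`). In particular `A` is rational.

The substitution `(z, q) ↦ (z⁻¹, q⁻¹)` multiplies `U`, `V` and `1 - z` by monomials, and negates the factor
`q - q⁻¹` of the numerator. For `(n, m) ≠ (0, 0)` the numerator has smaller degree in `q` than the
denominator, so that neither part has a pole at `q = ∞`, and both vanish at `q = 0`. The substituted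
decomposition is then again one of the same kind, and uniqueness of partial fractions
(`reflect_map_partialFraction`) gives the reciprocity for `τ / U`. The sign and the power of `z` come from
counting the `w + 1` factors of the denominator.
-/

namespace SL2Plethysm

open LaurentPolynomial (T invert)

/-! ### Symmetric `q`-binomial coefficients -/

/-- The symmetric `q`-binomial coefficient `[k + l]_q! / ([k]_q! [l]_q!)`, a Laurent polynomial in `q`.
It is defined by a Pascal recursion, which avoids division. -/
noncomputable def qBinom : ℕ → ℕ → LaurentPolynomial ℤ
  | 0, _ => 1
  | _ + 1, 0 => 1
  | k + 1, l + 1 => T (-(l + 1 : ℤ)) * qBinom k (l + 1) + T (k + 1 : ℤ) * qBinom (k + 1) l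

@[simp] theorem qBinom_zero_left (l : ℕ) : qBinom 0 l = 1 := by rw [qBinom]

@[simp] theorem qBinom_zero_right (k : ℕ) : qBinom k 0 = 1 := by cases k <;> rw [qBinom]

theorem qBinom_succ_succ (k l : ℕ) : qBinom (k + 1) (l + 1) =
    T (-(l + 1 : ℤ)) * qBinom k (l + 1) + T (k + 1 : ℤ) * qBinom (k + 1) l := by
  rw [qBinom]

/-- The product `∏_{i = 1}^k (q^i - q^{-i})`, which is `[k]_q!` up to a power of `q - q⁻¹`. -/
noncomputable def qFact (k : ℕ) : LaurentPolynomial ℤ :=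
  ∏ i ∈ Finset.range k, (T (i + 1 : ℤ) - T (-(i + 1 : ℤ)))

theorem qFact_succ (k : ℕ) :
    qFact (k + 1) = qFact k * (T (k + 1 : ℤ) - T (-(k + 1 : ℤ))) := by
  rw [qFact, Finset.prod_range_succ, ← qFact]

theorem T_sub_T_neg_ne_zero {k : ℤ} (hk : k ≠ 0) :
    (T k - T (-k) : LaurentPolynomial ℤ) ≠ 0 := by
  intro h
  have h1 := congrArg (fun f => f.coeff k) h
  have hkk : -k ≠ k := by omega
  simp [hkk] at h1

theorem qFact_ne_zero (k : ℕ) : qFact k ≠ 0 :=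
  Finset.prod_ne_zero_iff.2 fun i _ => T_sub_T_neg_ne_zero (by omega)

theorem qFact_mul_qFact_mul_qBinom (k l : ℕ) :
    qFact k * qFact l * qBinom k l = qFact (k + l) := by
  induction k generalizing l with
  | zero => simp [qFact]
  | succ k ihk =>
    induction l with
    | zero => simp [qFact]
    | succ l ihl =>
      have h1 := ihk (l + 1)
      rw [show k + 1 + (l + 1) = (k + 1 + l) + 1 by ring, qFact_succ (k + 1 + l), qBinom_succ_succ]
      rw [show k + (l + 1) = k + 1 + l by ring] at h1
      rw [qFact_succ l] at h1 ⊢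
      rw [qFact_succ k] at ihl ⊢
      have e1 : (T (((k + 1 + l : ℕ) : ℤ) + 1) : LaurentPolynomial ℤ) =
          T (k + 1 : ℤ) * T (l + 1 : ℤ) := by
        rw [← LaurentPolynomial.T_add]; rfl
      have e2 : (T (-(((k + 1 + l : ℕ) : ℤ) + 1)) : LaurentPolynomial ℤ) =
          T (-(k + 1 : ℤ)) * T (-(l + 1 : ℤ)) := by
        rw [← LaurentPolynomial.T_add]; congr 1; push_cast; ring
      rw [e1, e2]
      linear_combination (T (-(l + 1 : ℤ)) * (T (k + 1 : ℤ) - T (-(k + 1 : ℤ)))) * h1 +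
        (T (k + 1 : ℤ) * (T (l + 1 : ℤ) - T (-(l + 1 : ℤ)))) * ihl

/-- Both sides are the `q`-trinomial coefficient `[n + m + a]_q! / ([n]_q! [m]_q! [a]_q!)`. -/
theorem qBinom_mul_qBinom (n m a : ℕ) :
    qBinom n (m + a) * qBinom m a = qBinom (n + m) a * qBinom n m := by
  have h1 := qFact_mul_qFact_mul_qBinom n (m + a)
  have h2 := qFact_mul_qFact_mul_qBinom m a
  have h3 := qFact_mul_qFact_mul_qBinom (n + m) a
  have h4 := qFact_mul_qFact_mul_qBinom n m
  rw [← add_assoc] at h1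
  refine mul_left_cancel₀ (mul_ne_zero (mul_ne_zero (qFact_ne_zero n) (qFact_ne_zero m))
    (qFact_ne_zero a)) ?_
  linear_combination qFact n * qBinom n (m + a) * h2 + h1 - h3 -
    qFact a * qBinom (n + m) a * h4

theorem invert_qFact (k : ℕ) : invert (qFact k) = (-1) ^ k * qFact k := by
  induction k with
  | zero => simp [qFact]
  | succ k ih =>
    rw [qFact_succ, map_mul, ih, map_sub, LaurentPolynomial.invert_T, LaurentPolynomial.invert_T,
      neg_neg]
    ring

theorem invert_qBinom (k l : ℕ) : invert (qBinom k l) = qBinom k l := by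
  have h := qFact_mul_qFact_mul_qBinom k l
  have h2 := congrArg invert h
  rw [map_mul, map_mul, invert_qFact, invert_qFact, invert_qFact, ← h, pow_add] at h2
  have hne : (-1 : LaurentPolynomial ℤ) ^ k * (-1) ^ l * (qFact k * qFact l) ≠ 0 :=
    mul_ne_zero (mul_ne_zero (pow_ne_zero _ (by simp)) (pow_ne_zero _ (by simp)))
      (mul_ne_zero (qFact_ne_zero k) (qFact_ne_zero l))
  refine mul_left_cancel₀ hne ?_
  linear_combination h2

theorem coeff_T_mul (k j : ℤ) (f : LaurentPolynomial ℤ) :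
    (T k * f).coeff j = f.coeff (j - k) := by
  have := AddMonoidAlgebra.coeff_single_mul_apply f (1 : ℤ) k j
  rw [T, this, one_mul, neg_add_eq_sub]

theorem coeff_qBinom_eq_zero {k l : ℕ} {j : ℤ} (hj : (k * l : ℤ) < j) :
    (qBinom k l).coeff j = 0 := by
  induction k generalizing l j with
  | zero =>
    have : (qBinom 0 l) = T 0 := by simp
    rw [this, LaurentPolynomial.T_apply, if_neg]
    simp at hj; omega
  | succ k ihk =>
    induction l generalizing j with
    | zero =>
      have : (qBinom (k + 1) 0) = T 0 := by simp
      rw [this, LaurentPolynomial.T_apply, if_neg]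
      simp at hj; omega
    | succ l ihl =>
      rw [qBinom_succ_succ, AddMonoidAlgebra.coeff_add, Finsupp.add_apply, coeff_T_mul, coeff_T_mul,
        ihk, ihl, add_zero]
      · push_cast at hj ⊢
        linarith
      · push_cast at hj ⊢
        nlinarith

/-! ### Hook tableaux -/

theorem mem_hook {n m i j : ℕ} :
    (i, j) ∈ hook n m ↔ (i = 0 ∧ j < n + 1) ∨ (j = 0 ∧ i < m + 1) := by
  rw [hook, YoungDiagram.mem_ofRowLens]
  cases i with
  | zero => simp; omega
  | succ i => simp; omega

theorem cells_hook (n m : ℕ) : (hook n m).cells =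
    (Finset.range (n + 1)).image (fun j => ((0, j) : ℕ × ℕ)) ∪
      (Finset.range m).image (fun i => ((i + 1, 0) : ℕ × ℕ)) := by
  ext ⟨i, j⟩
  rw [YoungDiagram.mem_cells, mem_hook]
  simp only [Finset.mem_union, Finset.mem_image, Finset.mem_range, Prod.mk.injEq]
  constructor
  · rintro (⟨rfl, hj⟩ | ⟨rfl, hi⟩)
    · exact Or.inl ⟨j, hj, rfl, rfl⟩
    · cases i with
      | zero => exact Or.inl ⟨0, by omega, rfl, rfl⟩
      | succ i => exact Or.inr ⟨i, by omega, rfl, rfl⟩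
  · rintro (⟨a, ha, rfl, rfl⟩ | ⟨a, ha, rfl, rfl⟩) <;> omega

theorem prod_cells_hook {R : Type*} [CommMonoid R] (n m : ℕ) (φ : ℕ × ℕ → R) :
    ∏ c ∈ (hook n m).cells, φ c =
      φ (0, 0) * (∏ j : Fin n, φ (0, j + 1)) * ∏ i : Fin m, φ (i + 1, 0) := by
  rw [cells_hook, Finset.prod_union, Finset.prod_image (fun a _ b _ hab => by simpa using hab),
    Finset.prod_image (fun a _ b _ hab => by simpa using hab), Finset.prod_range_succ',
    mul_comm (φ (0, 0)), Finset.prod_range, Finset.prod_range]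
  rw [Finset.disjoint_left]
  rintro ⟨i, j⟩ h1 h2
  simp only [Finset.mem_image, Finset.mem_range, Prod.mk.injEq] at h1 h2
  omega

theorem card_hook (n m : ℕ) : (hook n m).card = n + m + 1 := by
  rw [YoungDiagram.card, cells_hook, Finset.card_union_of_disjoint,
    Finset.card_image_of_injective, Finset.card_image_of_injective, Finset.card_range,
    Finset.card_range]
  · ring
  · intro a b hab; simpa using hab
  · intro a b hab; simpa using hab
  · rw [Finset.disjoint_left]
    rintro ⟨i, j⟩ h1 h2
    simp only [Finset.mem_image, Finset.mem_range, Prod.mk.injEq] at h1 h2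
    omega

/-- The data of a hook tableau over `{0, …, N - 1}`: the corner entry `v`, the entries of the arm
(weakly increasing from `v`) and the entries of the leg (strictly increasing from `v`). -/
abbrev HookFilling (n m N : ℕ) : Type :=
  {t : Fin N × (Fin n → Fin N) × (Fin m → Fin N) //
    Monotone (Matrix.vecCons t.1 t.2.1) ∧ StrictMono (Matrix.vecCons t.1 t.2.2)}

/-- The tableau with the given corner, arm and leg. -/
def HookFilling.toTableau {n m N : ℕ} (t : HookFilling n m N) : BoundedSSYT (hook n m) N :=
  ⟨{ entry := fun i j =>
      if j = 0 then
        if hi : i < m + 1 then ((Matrix.vecCons t.1.1 t.1.2.2 ⟨i, hi⟩ : Fin N) : ℕ) else 0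
      else if i = 0 then
        if hj : j < n + 1 then ((Matrix.vecCons t.1.1 t.1.2.1 ⟨j, hj⟩ : Fin N) : ℕ) else 0
      else 0
     row_weak' := by
      intro i j1 j2 hj hc
      rcases mem_hook.1 hc with ⟨rfl, h2⟩ | ⟨rfl, h2⟩
      · rw [if_neg (by omega : ¬ j2 = 0), if_pos rfl, dif_pos h2]
        have hm := t.2.1 (show (⟨j1, by omega⟩ : Fin (n + 1)) ≤ ⟨j2, h2⟩ from hj.le)
        by_cases h0 : j1 = 0
        · subst h0
          rw [if_pos rfl, dif_pos (by omega)]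
          exact hm
        · rw [if_neg h0, if_pos rfl, dif_pos (by omega)]
          exact hm
      · omega
     col_strict' := by
      intro i1 i2 j hi hc
      rcases mem_hook.1 hc with ⟨rfl, h2⟩ | ⟨rfl, h2⟩
      · omega
      · rw [if_pos rfl, if_pos rfl, dif_pos (by omega), dif_pos h2]
        exact t.2.2 (show (⟨i1, by omega⟩ : Fin (m + 1)) < ⟨i2, h2⟩ from hi)
     zeros' := by
      intro i j hc
      rw [mem_hook] at hc
      split_ifs <;> first | rfl | omega }, by
    intro c hc
    change (if _ then _ else _) < N
    rcases mem_hook.1 hc with ⟨h1, h2⟩ | ⟨h1, h2⟩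
    · by_cases h0 : c.2 = 0
      · rw [if_pos h0, dif_pos (by omega)]
        exact Fin.is_lt _
      · rw [if_neg h0, if_pos h1, dif_pos h2]
        exact Fin.is_lt _
    · rw [if_pos h1, dif_pos h2]
      exact Fin.is_lt _⟩

theorem HookFilling.toTableau_apply {n m N : ℕ} (t : HookFilling n m N) (i j : ℕ) :
    t.toTableau.1 i j =
      if j = 0 then
        if hi : i < m + 1 then ((Matrix.vecCons t.1.1 t.1.2.2 ⟨i, hi⟩ : Fin N) : ℕ) else 0
      else if i = 0 then
        if hj : j < n + 1 then ((Matrix.vecCons t.1.1 t.1.2.1 ⟨j, hj⟩ : Fin N) : ℕ) else 0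
      else 0 := rfl

theorem HookFilling.toTableau_row {n m N : ℕ} (t : HookFilling n m N) {j : ℕ} (hj : j < n + 1) :
    t.toTableau.1 0 j = ((Matrix.vecCons t.1.1 t.1.2.1 ⟨j, hj⟩ : Fin N) : ℕ) := by
  rw [toTableau_apply]
  by_cases h0 : j = 0
  · subst h0
    rw [if_pos rfl, dif_pos (by omega)]
    rfl
  · rw [if_neg h0, if_pos rfl, dif_pos hj]

theorem HookFilling.toTableau_col {n m N : ℕ} (t : HookFilling n m N) {i : ℕ} (hi : i < m + 1) :
    t.toTableau.1 i 0 = ((Matrix.vecCons t.1.1 t.1.2.2 ⟨i, hi⟩ : Fin N) : ℕ) := by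
  rw [toTableau_apply, if_pos rfl, dif_pos hi]

theorem HookFilling.toTableau_bijective (n m N : ℕ) :
    Function.Bijective (HookFilling.toTableau : HookFilling n m N → _) := by
  constructor
  · intro s t hst
    have hr : ∀ (j : ℕ) (hj : j < n + 1), Matrix.vecCons s.1.1 s.1.2.1 ⟨j, hj⟩ =
        Matrix.vecCons t.1.1 t.1.2.1 ⟨j, hj⟩ := fun j hj => by
      apply Fin.ext
      rw [← s.toTableau_row, ← t.toTableau_row, hst]
    have hc : ∀ (j : ℕ) (hj : j < m + 1), Matrix.vecCons s.1.1 s.1.2.2 ⟨j, hj⟩ =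
        Matrix.vecCons t.1.1 t.1.2.2 ⟨j, hj⟩ := fun j hj => by
      apply Fin.ext
      rw [← s.toTableau_col, ← t.toTableau_col, hst]
    apply Subtype.ext
    refine Prod.ext (hr 0 n.succ_pos) (Prod.ext ?_ ?_)
    · funext j
      exact hr (j + 1) (by omega)
    · funext i
      exact hc (i + 1) (by omega)
  · intro S
    have hrow : ∀ j : Fin (n + 1), S.1 0 j < N := fun j =>
      S.2 (0, j) (mem_hook.2 (Or.inl ⟨rfl, j.2⟩))
    have hcol : ∀ i : Fin (m + 1), S.1 i 0 < N := fun i =>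
      S.2 (i, 0) (mem_hook.2 (Or.inr ⟨rfl, i.2⟩))
    have er : (Matrix.vecCons ⟨S.1 0 0, hrow 0⟩ fun j : Fin n => ⟨S.1 0 (j + 1), hrow j.succ⟩ :
        Fin (n + 1) → Fin N) = fun j => ⟨S.1 0 j, hrow j⟩ := by
      funext j
      refine Fin.cases rfl (fun j => rfl) j
    have ec : (Matrix.vecCons ⟨S.1 0 0, hrow 0⟩ fun i : Fin m => ⟨S.1 (i + 1) 0, hcol i.succ⟩ :
        Fin (m + 1) → Fin N) = fun i => ⟨S.1 i 0, hcol i⟩ := by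
      funext j
      refine Fin.cases rfl (fun j => rfl) j
    refine ⟨⟨(⟨S.1 0 0, hrow 0⟩, fun j => ⟨S.1 0 (j + 1), hrow j.succ⟩,
      fun i => ⟨S.1 (i + 1) 0, hcol i.succ⟩), ?_, ?_⟩, ?_⟩
    · dsimp only
      rw [er]
      intro a b hab
      exact S.1.row_weak_of_le hab (mem_hook.2 (Or.inl ⟨rfl, b.2⟩))
    · dsimp only
      rw [ec]
      intro a b hab
      exact S.1.col_strict hab (mem_hook.2 (Or.inr ⟨rfl, b.2⟩))
    · apply Subtype.ext
      ext i j
      by_cases h : (i, j) ∈ hook n m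
      · rcases mem_hook.1 h with ⟨rfl, hj⟩ | ⟨rfl, hi⟩
        · rw [HookFilling.toTableau_row _ hj]
          dsimp only
          rw [er]
        · rw [HookFilling.toTableau_col _ hi]
          dsimp only
          rw [ec]
      · rw [S.1.zeros h, SemistandardYoungTableau.zeros _ h]

/-- The complete homogeneous symmetric polynomial of degree `n` in `x_v, …, x_{N-1}`. -/
def rowSum {R : Type*} [CommSemiring R] (x : ℕ → R) (N : ℕ) : ℕ → ℕ → R
  | 0, _ => 1
  | n + 1, v => ∑ u ∈ Finset.Ico v N, x u * rowSum x N n u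

/-- The elementary symmetric polynomial of degree `m` in `x_{v+1}, …, x_{N-1}`. -/
def colSum {R : Type*} [CommSemiring R] (x : ℕ → R) (N : ℕ) : ℕ → ℕ → R
  | 0, _ => 1
  | m + 1, v => ∑ u ∈ Finset.Ico (v + 1) N, x u * colSum x N m u

theorem sum_fin_ite_le {R : Type*} [AddCommMonoid R] (v N : ℕ) (φ : ℕ → R) :
    ∑ u : Fin N, (if v ≤ u then φ u else 0) = ∑ u ∈ Finset.Ico v N, φ u := by
  rw [Fin.sum_univ_eq_sum_range (fun u => if v ≤ u then φ u else 0), ← Finset.sum_filter]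
  refine Finset.sum_congr ?_ fun _ _ => rfl
  ext u
  simp only [Finset.mem_filter, Finset.mem_range, Finset.mem_Ico]
  omega

open Classical in
theorem sum_monotone_eq_rowSum {R : Type*} [CommSemiring R] (x : ℕ → R) {N : ℕ} (n : ℕ)
    (v : Fin N) :
    ∑ f : Fin n → Fin N, (if Monotone (Matrix.vecCons v f) then ∏ i, x (f i) else 0) =
      rowSum x N n v := by
  induction n generalizing v with
  | zero =>
    rw [rowSum, Fintype.sum_unique, if_pos (Subsingleton.monotone _)]
    simp
  | succ n ih =>
    rw [rowSum, ← sum_fin_ite_le, ← (Fin.consEquiv fun _ => Fin N).sum_comp,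
      Fintype.sum_prod_type]
    refine Finset.sum_congr rfl fun u _ => ?_
    have hmon : ∀ f : Fin n → Fin N, Monotone (Matrix.vecCons v (Fin.cons u f : Fin (n + 1) → Fin N)) ↔
        v ≤ u ∧ Monotone (Matrix.vecCons u f) := fun f => monotone_vecCons
    simp only [Fin.consEquiv, Equiv.coe_fn_mk, hmon, Fin.prod_univ_succ, Fin.cons_zero,
      Fin.cons_succ]
    by_cases hvu : v ≤ u
    · rw [if_pos (by exact hvu), ← ih u, Finset.mul_sum]
      simp [hvu]
    · rw [if_neg (by exact hvu)]
      simp [hvu]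

open Classical in
theorem sum_strictMono_eq_colSum {R : Type*} [CommSemiring R] (x : ℕ → R) {N : ℕ} (m : ℕ)
    (v : Fin N) :
    ∑ f : Fin m → Fin N, (if StrictMono (Matrix.vecCons v f) then ∏ i, x (f i) else 0) =
      colSum x N m v := by
  induction m generalizing v with
  | zero =>
    rw [colSum, Fintype.sum_unique, if_pos (Subsingleton.strictMono _)]
    simp
  | succ n ih =>
    rw [colSum, ← sum_fin_ite_le, ← (Fin.consEquiv fun _ => Fin N).sum_comp,
      Fintype.sum_prod_type]
    refine Finset.sum_congr rfl fun u _ => ?_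
    have hmon : ∀ f : Fin n → Fin N,
        StrictMono (Matrix.vecCons v (Fin.cons u f : Fin (n + 1) → Fin N)) ↔
        v < u ∧ StrictMono (Matrix.vecCons u f) := fun f => strictMono_vecCons
    simp only [Fin.consEquiv, Equiv.coe_fn_mk, hmon, Fin.prod_univ_succ, Fin.cons_zero,
      Fin.cons_succ]
    by_cases hvu : v < u
    · rw [if_pos (by exact hvu), ← ih u, Finset.mul_sum]
      simp [hvu]
    · rw [if_neg (by exact hvu)]
      simp [hvu]

theorem schur_hook {R : Type*} [CommSemiring R] (n m N : ℕ) (x : ℕ → R) :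
    schur (hook n m) (fun i : Fin N => x i) =
      ∑ v ∈ Finset.Ico 0 N, x v * rowSum x N n v * colSum x N m v := by
  classical
  rw [schur, ← (HookFilling.toTableau_bijective n m N).sum_comp]
  have hterm : ∀ t : HookFilling n m N,
      ∏ c : (hook n m).cells, x (t.toTableau.1 c.1.1 c.1.2) =
        x t.1.1 * (∏ j, x (t.1.2.1 j)) * ∏ i, x (t.1.2.2 i) := by
    intro t
    rw [Finset.prod_coe_sort (hook n m).cells (fun c => x (t.toTableau.1 c.1 c.2)),
      prod_cells_hook]
    have h0 := t.toTableau_row (j := 0) (by omega)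
    have h1 : ∀ j : Fin n, t.toTableau.1 0 (j + 1) = t.1.2.1 j := fun j =>
      t.toTableau_row (by omega)
    have h2 : ∀ i : Fin m, t.toTableau.1 (i + 1) 0 = t.1.2.2 i := fun i =>
      t.toTableau_col (by omega)
    simp only [h0, h1, h2]
    rfl
  simp only [hterm]
  rw [← Finset.sum_subtype (Finset.univ.filter
    fun t : Fin N × (Fin n → Fin N) × (Fin m → Fin N) =>
    Monotone (Matrix.vecCons t.1 t.2.1) ∧ StrictMono (Matrix.vecCons t.1 t.2.2)) (by simp)
    (fun t => x t.1 * (∏ j, x (t.2.1 j)) * ∏ i, x (t.2.2 i)), Finset.sum_filter,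
    Fintype.sum_prod_type, Finset.sum_Ico_eq_sum_range, Finset.sum_range]
  simp only [Nat.sub_zero, zero_add]
  refine Finset.sum_congr rfl fun v _ => ?_
  rw [← sum_monotone_eq_rowSum, ← sum_strictMono_eq_colSum, mul_assoc, Finset.sum_mul_sum,
    Finset.mul_sum, Fintype.sum_prod_type]
  refine Finset.sum_congr rfl fun f _ => ?_
  rw [Finset.mul_sum]
  refine Finset.sum_congr rfl fun g _ => ?_
  by_cases h1 : Monotone (Matrix.vecCons v f)
  · by_cases h2 : StrictMono (Matrix.vecCons v g)
    · simp only [h1, h2, and_self, if_true, mul_assoc]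
    · simp [h2]
  · simp [h1]

/-! ### The principal specialization of a hook Schur polynomial -/

/-- The monomial `q^{2 i - h}`, with `i` a natural number. -/
noncomputable def balancedVar (h i : ℕ) : LaurentPolynomial ℤ := T (2 * (i : ℤ) - h)

theorem rowSum_balancedVar (h n v l : ℕ) (hv : v + l = h) :
    rowSum (balancedVar h) (h + 1) n v = T (n * v) * qBinom n l := by
  induction n generalizing v l with
  | zero => simp [rowSum]
  | succ n ihn =>
    induction l generalizing v with
    | zero =>
      rw [rowSum, Finset.sum_eq_sum_Ico_succ_bot (by omega), Finset.Ico_eq_empty (by omega),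
        ihn v 0 hv, Finset.sum_empty, add_zero, balancedVar, ← mul_assoc, qBinom_zero_right,
        qBinom_zero_right, ← LaurentPolynomial.T_add]
      subst hv
      congr 2
      push_cast
      ring
    | succ l ihl =>
      have ih := ihl (v + 1) (by omega)
      rw [rowSum] at ih ⊢
      rw [Finset.sum_eq_sum_Ico_succ_bot (by omega), ih, ihn v (l + 1) hv, qBinom_succ_succ, mul_add,
        balancedVar, ← mul_assoc, ← mul_assoc, ← mul_assoc]
      subst hv
      simp only [← LaurentPolynomial.T_add]
      congr 3
      push_cast
      ring

theorem colSum_balancedVar_eq_zero (h m v l : ℕ) (hv : v + l = h) (hl : l < m) :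
    colSum (balancedVar h) (h + 1) m v = 0 := by
  induction m generalizing v l with
  | zero => omega
  | succ m ih =>
    rw [colSum]
    refine Finset.sum_eq_zero fun u hu => ?_
    rw [Finset.mem_Ico] at hu
    rw [ih u (h - u) (by omega) (by omega), mul_zero]

theorem colSum_balancedVar (h m v c : ℕ) (hv : v + (m + c) = h) :
    colSum (balancedVar h) (h + 1) m v = T (m * (v + 1)) * qBinom m c := by
  induction m generalizing v c with
  | zero => simp [colSum]
  | succ m ihm =>
    induction c generalizing v with
    | zero =>
      have h0 := colSum_balancedVar_eq_zero h (m + 1) (v + 1) m (by omega) (by omega)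
      rw [colSum] at h0 ⊢
      rw [Finset.sum_eq_sum_Ico_succ_bot (by omega), h0, ihm (v + 1) 0 (by omega), add_zero,
        balancedVar, ← mul_assoc, qBinom_zero_right, qBinom_zero_right, ← LaurentPolynomial.T_add]
      subst hv
      congr 2
      push_cast
      ring
    | succ c ihc =>
      have ih := ihc (v + 1) (by omega)
      rw [colSum] at ih ⊢
      rw [Finset.sum_eq_sum_Ico_succ_bot (by omega), ih, ihm (v + 1) (c + 1) (by omega),
        qBinom_succ_succ, mul_add (T _), balancedVar, ← mul_assoc, ← mul_assoc, ← mul_assoc]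
      subst hv
      simp only [← LaurentPolynomial.T_add]
      congr 3
      push_cast
      ring

/-- A hook with `m + 1` rows has no tableaux over the `l + 1 ≤ m` letters `v, …, h`. -/
theorem sum_balancedVar_eq_zero (h n m v l : ℕ) (hv : v + l = h) (hl : l < m) :
    ∑ u ∈ Finset.Ico v (h + 1), balancedVar h u * rowSum (balancedVar h) (h + 1) n u *
      colSum (balancedVar h) (h + 1) m u = 0 := by
  refine Finset.sum_eq_zero fun u hu => ?_
  rw [Finset.mem_Ico] at hu
  rw [colSum_balancedVar_eq_zero h m u (h - u) (by omega) (by omega), mul_zero]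

/-- The Schur polynomial of a hook in `x_v, …, x_h`, by splitting off the tableaux with `v` in the
corner: the recursion is Pascal's rule for `qBinom (n + m + 1) a`. -/
theorem sum_balancedVar (h n m v a : ℕ) (hv : v + (m + a) = h) :
    ∑ u ∈ Finset.Ico v (h + 1), balancedVar h u * rowSum (balancedVar h) (h + 1) n u *
      colSum (balancedVar h) (h + 1) m u =
    T ((n + m + 1) * v) * (qBinom (n + m + 1) a * qBinom n m) := by
  have step : ∀ v a, v + (m + a) = h →
      balancedVar h v * rowSum (balancedVar h) (h + 1) n v * colSum (balancedVar h) (h + 1) m v =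
        T ((n + m + 1) * v) * (T (-(a : ℤ)) * (qBinom (n + m) a * qBinom n m)) := by
    intro v a hv
    rw [rowSum_balancedVar h n v (m + a) hv, colSum_balancedVar h m v a hv, ← qBinom_mul_qBinom,
      balancedVar]
    have hT : (T (2 * (v : ℤ) - h) * T (n * v) * T (m * (v + 1)) : LaurentPolynomial ℤ) =
        T ((n + m + 1) * v) * T (-(a : ℤ)) := by
      subst hv
      simp only [← LaurentPolynomial.T_add]
      congr 1
      push_cast
      ring
    linear_combination qBinom n (m + a) * qBinom m a * hT
  induction a generalizing v with
  | zero =>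
    rw [Finset.sum_eq_sum_Ico_succ_bot (by omega), step v 0 hv]
    cases m with
    | zero => rw [Finset.Ico_eq_empty (by omega)]; simp
    | succ m => rw [sum_balancedVar_eq_zero h n (m + 1) (v + 1) m (by omega) (by omega)]; simp
  | succ a ih =>
    rw [Finset.sum_eq_sum_Ico_succ_bot (by omega), step v (a + 1) hv, ih (v + 1) (by omega),
      qBinom_succ_succ]
    have hT : (T ((n + m + 1) * ((v + 1 : ℕ) : ℤ)) : LaurentPolynomial ℤ) =
        T ((n + m + 1) * v) * T (((n + m : ℕ) : ℤ) + 1) := by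
      rw [← LaurentPolynomial.T_add]
      congr 1
    rw [hT]
    push_cast
    ring

theorem plethysm_hook_eq_sum (n m h : ℕ) : plethysm (hook n m) h =
    ∑ u ∈ Finset.Ico 0 (h + 1), balancedVar h u * rowSum (balancedVar h) (h + 1) n u *
      colSum (balancedVar h) (h + 1) m u :=
  schur_hook n m (h + 1) (balancedVar h)

theorem plethysm_hook_of_lt {n m h : ℕ} (hm : h < m) : plethysm (hook n m) h = 0 := by
  rw [plethysm_hook_eq_sum]
  exact sum_balancedVar_eq_zero h n m 0 h (by omega) hm

/-- The hook content formula for `s_μ(q^{-h}, …, q^h)`, `h = m + a`. -/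
theorem plethysm_hook_add (n m a : ℕ) :
    plethysm (hook n m) (m + a) = qBinom (n + m + 1) a * qBinom n m := by
  rw [plethysm_hook_eq_sum, sum_balancedVar (m + a) n m 0 a (by omega)]
  simp

theorem invert_plethysm_hook (n m h : ℕ) :
    invert (plethysm (hook n m) h) = plethysm (hook n m) h := by
  rcases Nat.lt_or_ge h m with hm | hm
  · rw [plethysm_hook_of_lt hm, map_zero]
  · obtain ⟨a, rfl⟩ := Nat.exists_eq_add_of_le hm
    rw [plethysm_hook_add, map_mul, invert_qBinom, invert_qBinom]

/-! ### Expansion in `q`-integers -/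

/-- The coefficient of `[k]_q` in `f` is `f_{k-1} - f_{k+1}`. -/
theorem exists_isQIntExpansion_of_invert_eq {f : LaurentPolynomial ℤ} (hf : invert f = f) :
    ∃ a, IsQIntExpansion f a := by
  have hsymm : ∀ j, f.coeff (-j) = f.coeff j := fun j => by
    conv_rhs => rw [← hf]
    rw [LaurentPolynomial.invert_apply]
  set g := (T 1 - T (-1)) * f with hg
  have hgc : ∀ j, g.coeff j = f.coeff (j - 1) - f.coeff (j + 1) := fun j => by
    rw [hg, sub_mul, AddMonoidAlgebra.coeff_sub, Finsupp.sub_apply, coeff_T_mul, coeff_T_mul,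
      sub_neg_eq_add]
  have hanti : ∀ j, g.coeff (-j) = -g.coeff j := fun j => by
    rw [hgc, hgc, ← hsymm (-j - 1), ← hsymm (-j + 1)]
    ring_nf
  let a : ℕ →₀ ℤ := Finsupp.comapDomain (fun k : ℕ => (k : ℤ)) g.coeff
    (Nat.cast_injective.injOn)
  have ha : ∀ k : ℕ, a k = g.coeff k := fun k => rfl
  have ha0 : a 0 = 0 := by
    have := hanti 0
    rw [ha]
    simp only [neg_zero, Nat.cast_zero] at this ⊢
    omega
  refine ⟨a, ha0, ?_⟩
  refine mul_left_cancel₀ (T_sub_T_neg_ne_zero one_ne_zero) ?_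
  rw [← hg, Finsupp.mul_sum]
  have hterm : (a.sum fun k c => (T 1 - T (-1)) * (c • qInt k)) =
      a.sum fun k c => c • (T k - T (-k) : LaurentPolynomial ℤ) :=
    Finsupp.sum_congr fun k _ => by rw [mul_smul_comm, qInt_spec]
  rw [hterm]
  refine LaurentPolynomial.ext fun j => ?_
  rw [Finsupp.sum, AddMonoidAlgebra.coeff_sum, Finsupp.finsetSum_apply]
  have hc : ∀ k ∈ a.support, (a k • (T k - T (-k) : LaurentPolynomial ℤ)).coeff j =
      (if (k : ℤ) = j then a k else 0) - if -(k : ℤ) = j then a k else 0 := by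
    intro k _
    rw [AddMonoidAlgebra.coeff_smul, Finsupp.smul_apply, AddMonoidAlgebra.coeff_sub,
      Finsupp.sub_apply, LaurentPolynomial.T_apply, LaurentPolynomial.T_apply]
    split_ifs <;> simp
  rw [Finset.sum_congr rfl hc, Finset.sum_sub_distrib]
  have hsum : ∀ i : ℕ, (∑ k ∈ a.support, if k = i then a k else 0) = a i := fun i => by
    rw [Finset.sum_ite_eq']
    split_ifs with h
    · rfl
    · simpa using (Finsupp.notMem_support_iff.1 h).symm
  have h0 := hanti 0
  obtain ⟨i, rfl | rfl⟩ := Int.eq_nat_or_neg j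
  · simp only [Nat.cast_inj]
    rw [hsum i, ← ha]
    rcases Nat.eq_zero_or_pos i with rfl | hi
    · simp [hsum, ha0]
    · rw [Finset.sum_eq_zero, sub_zero]
      intro k _
      rw [if_neg (by omega)]
  · simp only [neg_inj, Nat.cast_inj]
    rw [hsum i, hanti, ← ha]
    rcases Nat.eq_zero_or_pos i with rfl | hi
    · simp [hsum, ha0]
    · rw [Finset.sum_eq_zero, zero_sub]
      intro k _
      rw [if_neg (by omega)]

/-- The defining property of `A_μ`: its coefficients are the parts of positive degree in `q` of
`(q - q⁻¹) s_μ[s_h](q⁻¹, q)`. -/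
theorem toLaurent_coeff_A {μ : YoungDiagram} {h : ℕ} (hμ : ∃ a, IsQIntExpansion (plethysm μ h) a) :
    toLaurent (PowerSeries.coeff h (A μ)) - invert (toLaurent (PowerSeries.coeff h (A μ))) =
      (T 1 - T (-1)) * plethysm μ h := by
  obtain ⟨a, ha⟩ := hμ
  have hA : PowerSeries.coeff h (A μ) = a.sum fun k c => Polynomial.monomial k c := by
    rw [A, PowerSeries.coeff_mk]
    simp only [plethysmCoeff, ha.qIntCoeff_eq]
    rfl
  rw [hA, Finsupp.sum, map_sum, map_sum, ← Finset.sum_sub_distrib]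
  conv_rhs => rw [ha.2, Finsupp.sum, Finset.mul_sum]
  refine Finset.sum_congr rfl fun k _ => ?_
  rw [mul_smul_comm, qInt_spec, ← C_mul_X_pow_eq_monomial, toLaurent_C_mul_X_pow, map_mul,
    LaurentPolynomial.invert_C, LaurentPolynomial.invert_T, LaurentPolynomial.smul_eq_C_mul,
    mul_sub]

theorem coeff_zero_coeff_A {μ : YoungDiagram} {h : ℕ}
    (hμ : ∃ a, IsQIntExpansion (plethysm μ h) a) : (PowerSeries.coeff h (A μ)).coeff 0 = 0 := by
  obtain ⟨a, ha⟩ := hμ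
  rw [A, PowerSeries.coeff_mk]
  simp only [plethysmCoeff, ha.qIntCoeff_eq, finsetSum_coeff, coeff_monomial]
  rw [Finset.sum_ite_eq']
  split_ifs
  · exact ha.1
  · rfl

/-! ### The generating function of the `q`-binomial coefficients -/

/-- The `q`-binomial theorem `∑_a qBinom k a z^a = ∏_{j = 0}^k (1 - q^{k - 2 j} z)⁻¹`. -/
theorem prod_mul_mk_qBinom (k : ℕ) :
    (∏ j ∈ Finset.range (k + 1), (1 - PowerSeries.C (T ((k : ℤ) - 2 * j)) * PowerSeries.X)) *
      PowerSeries.mk (qBinom k) = 1 := by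
  induction k with
  | zero =>
    have : PowerSeries.mk (qBinom 0) = PowerSeries.mk 1 := by
      ext1 a; simp
    rw [this]
    simpa [mul_comm] using PowerSeries.mk_one_mul_one_sub_eq_one (LaurentPolynomial ℤ)
  | succ k ih =>
    have hB : (1 - PowerSeries.C (T ((k + 1 : ℕ) : ℤ)) * PowerSeries.X) *
        PowerSeries.mk (qBinom (k + 1)) =
        PowerSeries.rescale (T (-1)) (PowerSeries.mk (qBinom k)) := by
      ext1 a
      rw [sub_mul, one_mul, map_sub, mul_assoc, PowerSeries.coeff_C_mul, PowerSeries.coeff_rescale,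
        PowerSeries.coeff_mk, PowerSeries.coeff_mk, LaurentPolynomial.T_pow]
      cases a with
      | zero => simp
      | succ a =>
        rw [PowerSeries.coeff_succ_X_mul, PowerSeries.coeff_mk, qBinom_succ_succ]
        push_cast
        rw [mul_neg_one, add_sub_cancel_right]
    have ih' := congrArg (PowerSeries.rescale (T (-1) : LaurentPolynomial ℤ)) ih
    rw [map_mul, map_prod, map_one] at ih'
    rw [Finset.prod_range_succ', mul_assoc]
    simp only [Nat.cast_zero, mul_zero, sub_zero]
    rw [hB]
    refine Eq.trans ?_ ih'
    congr 1
    refine Finset.prod_congr rfl fun j _ => ?_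
    have hC : ∀ a b : LaurentPolynomial ℤ,
        PowerSeries.rescale b (PowerSeries.C a) = PowerSeries.C a := fun a b => by
      ext1 i
      cases i <;> simp [PowerSeries.coeff_rescale, PowerSeries.coeff_C]
    rw [map_sub, map_mul, map_one, PowerSeries.rescale_X, hC, ← mul_assoc, ← map_mul,
      ← LaurentPolynomial.T_add]
    congr 4
    push_cast
    ring

/-! ### Denominators -/

/-- The factors `1 - z q^a` of `∏_{j = 0}^w (1 - z q^{w - 2 j})` with `a > 0`, as a polynomial in `q`. -/
noncomputable def upProd {K : Type*} [CommRing K] (z : K) (w : ℕ) : K[X] :=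
  ∏ j ∈ Finset.range ((w + 1) / 2), (1 - C z * X ^ (w - 2 * j))

/-- The factors `1 - z q^{-a}` of `∏_{j = 0}^w (1 - z q^{w - 2 j})` with `a > 0`, each multiplied by
`q^a`, as a monic polynomial in `q`. -/
noncomputable def downProd {K : Type*} [CommRing K] (z : K) (w : ℕ) : K[X] :=
  ∏ j ∈ Finset.range ((w + 1) / 2), (X ^ (w - 2 * j) - C z)

/-- The degree in `q` of `downProd z w`, and an upper bound for that of `upProd z w`. -/
def prodDegree (w : ℕ) : ℕ := ∑ j ∈ Finset.range ((w + 1) / 2), (w - 2 * j)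

theorem map_upProd {K L : Type*} [CommRing K] [CommRing L] (f : K →+* L) (z : K) (w : ℕ) :
    (upProd z w).map f = upProd (f z) w := by
  simp [upProd, Polynomial.map_prod]

theorem map_downProd {K L : Type*} [CommRing K] [CommRing L] (f : K →+* L) (z : K) (w : ℕ) :
    (downProd z w).map f = downProd (f z) w := by
  simp [downProd, Polynomial.map_prod]

theorem monic_downProd {K : Type*} [CommRing K] (z : K) (w : ℕ) : (downProd z w).Monic := by
  refine monic_prod_of_monic _ _ fun j hj => monic_X_pow_sub_C z ?_
  rw [Finset.mem_range] at hj
  omega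

theorem natDegree_downProd {K : Type*} [CommRing K] [Nontrivial K] (z : K) (w : ℕ) :
    (downProd z w).natDegree = prodDegree w := by
  rw [downProd, natDegree_prod_of_monic]
  · exact Finset.sum_congr rfl fun j _ => natDegree_X_pow_sub_C
  · intro j hj
    refine monic_X_pow_sub_C z ?_
    rw [Finset.mem_range] at hj
    omega

theorem degree_downProd {K : Type*} [CommRing K] [Nontrivial K] (z : K) (w : ℕ) :
    (downProd z w).degree = prodDegree w := by
  rw [degree_eq_natDegree (monic_downProd z w).ne_zero, natDegree_downProd]

theorem natDegree_upProd_le {K : Type*} [CommRing K] (z : K) (w : ℕ) :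
    (upProd z w).natDegree ≤ prodDegree w := by
  refine (natDegree_prod_le _ _).trans (Finset.sum_le_sum fun j _ => ?_)
  compute_degree

theorem reflect_upProd {K : Type*} [CommRing K] (z : K) (w : ℕ) :
    (upProd z w).reflect (prodDegree w) = downProd z w := by
  rw [upProd, prodDegree, downProd]
  generalize Finset.range ((w + 1) / 2) = s
  induction s using Finset.induction_on with
  | empty => simp
  | insert j s hj ih =>
    rw [Finset.prod_insert hj, Finset.sum_insert hj, Finset.prod_insert hj, reflect_mul, ih]
    · rw [reflect_sub, reflect_one, reflect_C_mul_X_pow, revAt_le le_rfl, Nat.sub_self, pow_zero,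
        mul_one]
    · compute_degree
    · refine (natDegree_prod_le _ _).trans (Finset.sum_le_sum fun j _ => ?_)
      compute_degree

theorem reflect_downProd {K : Type*} [CommRing K] (z : K) (w : ℕ) :
    (downProd z w).reflect (prodDegree w) = upProd z w := by
  rw [← reflect_upProd, reflect_reflect]

theorem upProd_inv {K : Type*} [Field K] {z : K} (hz : z ≠ 0) (w : ℕ) :
    upProd z⁻¹ w = C ((-z⁻¹) ^ ((w + 1) / 2)) * downProd z w := by
  rw [upProd, downProd, map_pow]
  conv_rhs => rw [← Finset.card_range ((w + 1) / 2), ← Finset.prod_const, Finset.card_range]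
  rw [← Finset.prod_mul_distrib]
  refine Finset.prod_congr rfl fun j _ => ?_
  have h1 : (C z⁻¹ * C z : K[X]) = 1 := by rw [← C_mul, inv_mul_cancel₀ hz, C_1]
  rw [C_neg]
  linear_combination -h1

theorem downProd_inv {K : Type*} [Field K] {z : K} (hz : z ≠ 0) (w : ℕ) :
    downProd z⁻¹ w = C ((-z⁻¹) ^ ((w + 1) / 2)) * upProd z w := by
  rw [upProd, downProd, map_pow]
  conv_rhs => rw [← Finset.card_range ((w + 1) / 2), ← Finset.prod_const, Finset.card_range]
  rw [← Finset.prod_mul_distrib]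
  refine Finset.prod_congr rfl fun j _ => ?_
  have h1 : (C z⁻¹ * C z : K[X]) = 1 := by rw [← C_mul, inv_mul_cancel₀ hz, C_1]
  rw [C_neg]
  linear_combination -X ^ (w - 2 * j) * h1

/-! ### Partial fractions in `q` -/

/-- Over `ℤ[z][q]`, two polynomials generate an ideal containing some `ρ ∈ ℤ[z]` with `ρ(0) = 1`.
The normalization makes `ρ` invertible as a power series in `z`. -/
def CoprimeInQ (x y : ℤ[X][X]) : Prop :=
  ∃ ρ : ℤ[X], ρ.coeff 0 = 1 ∧ ∃ a b : ℤ[X][X], a * x + b * y = C ρ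

theorem CoprimeInQ.symm {x y : ℤ[X][X]} (h : CoprimeInQ x y) : CoprimeInQ y x := by
  obtain ⟨ρ, h0, a, b, hab⟩ := h
  exact ⟨ρ, h0, b, a, by rw [add_comm, hab]⟩

theorem CoprimeInQ.mul_right {x y z : ℤ[X][X]} (hy : CoprimeInQ x y) (hz : CoprimeInQ x z) :
    CoprimeInQ x (y * z) := by
  obtain ⟨ρ, h0, a, b, hab⟩ := hy
  obtain ⟨ρ', h0', a', b', hab'⟩ := hz
  refine ⟨ρ * ρ', by rw [mul_coeff_zero, h0, h0', mul_one],
    a * a' * x + a * b' * z + b * a' * y, b * b', ?_⟩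
  rw [C_mul, ← hab, ← hab']
  ring

theorem CoprimeInQ.prod_right {ι : Type*} {x : ℤ[X][X]} {s : Finset ι} {f : ι → ℤ[X][X]}
    (h : ∀ i ∈ s, CoprimeInQ x (f i)) : CoprimeInQ x (∏ i ∈ s, f i) :=
  Finset.prod_induction f (CoprimeInQ x) (fun _ _ => CoprimeInQ.mul_right)
    ⟨1, by simp, 0, 1, by simp⟩ h

/-- `1 - z^{a+b}` is a combination of `1 - z q^a` and `q^b - z`: modulo the first `z^b q^{ab} = 1`,
modulo the second `q^{ab} = z^a`. -/
theorem coprimeInQ_factor {a : ℕ} (ha : 0 < a) (b : ℕ) :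
    CoprimeInQ (1 - C X * X ^ a) (X ^ b - C X) := by
  obtain ⟨c, hc⟩ := sub_dvd_pow_sub_pow (1 : ℤ[X][X]) (C X * X ^ a) b
  obtain ⟨d, hd⟩ := sub_dvd_pow_sub_pow (X ^ b : ℤ[X][X]) (C X) a
  refine ⟨1 - X ^ (a + b), by simp [coeff_X_pow]; omega, c, C X ^ b * d, ?_⟩
  rw [mul_comm c, ← hc, mul_assoc, mul_comm d, ← hd, C_sub, C_1, C_pow]
  ring

theorem coprimeInQ_upProd_downProd (w : ℕ) :
    CoprimeInQ (upProd (X : ℤ[X]) w) (downProd (X : ℤ[X]) w) := by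
  refine CoprimeInQ.prod_right fun i _ => (CoprimeInQ.prod_right fun j hj => ?_).symm
  refine (coprimeInQ_factor ?_ _).symm
  rw [Finset.mem_range] at hj
  omega

/-- The partial fraction decomposition `ρ β / (U V) = τ / U + σ / V` of a proper fraction, where
`U = upProd` and `V = downProd`. -/
theorem exists_partialFraction (w : ℕ) {β : ℤ[X][X]}
    (hβ : β.degree < ((prodDegree w + prodDegree w : ℕ) : WithBot ℕ)) :
    ∃ (ρ : ℤ[X]) (τ σ : ℤ[X][X]), ρ.coeff 0 = 1 ∧ τ.degree < prodDegree w ∧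
      σ.degree < prodDegree w ∧ C ρ * β = τ * downProd X w + σ * upProd X w := by
  obtain ⟨ρ, h0, a, b, hab⟩ := coprimeInQ_upProd_downProd w
  have hV := monic_downProd (X : ℤ[X]) w
  have hdiv := modByMonic_add_div (a * β) (downProd (X : ℤ[X]) w)
  have hσ := degree_modByMonic_lt (a * β) hV
  set σ := a * β %ₘ downProd X w
  set κ := a * β /ₘ downProd X w
  rw [degree_downProd] at hσ
  have heq : C ρ * β = (b * β + κ * upProd X w) * downProd X w + σ * upProd X w := by
    rw [← hab]
    linear_combination -upProd X w * hdiv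
  refine ⟨ρ, b * β + κ * upProd X w, σ, h0, ?_, hσ, heq⟩
  have h1 : ((b * β + κ * upProd X w) * downProd X w).degree <
      ((prodDegree w + prodDegree w : ℕ) : WithBot ℕ) := by
    rw [eq_sub_iff_add_eq.2 heq.symm]
    refine (degree_sub_le _ _).trans_lt (max_lt ?_ ?_)
    · refine lt_of_le_of_lt ?_ hβ
      refine (degree_mul_le _ _).trans ?_
      exact (add_le_add_left degree_C_le _).trans (by rw [zero_add])
    · refine (degree_mul_le _ _).trans_lt ?_
      rw [Nat.cast_add]
      have hU : (upProd (X : ℤ[X]) w).degree ≤ (prodDegree w : WithBot ℕ) :=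
        degree_le_of_natDegree_le (natDegree_upProd_le _ _)
      exact (add_le_add le_rfl hU).trans_lt
        (WithBot.add_lt_add_right (WithBot.natCast_ne_bot _) hσ)
  rw [hV.degree_mul, degree_downProd, Nat.cast_add] at h1
  exact lt_of_add_lt_add_right h1

/-- Uniqueness of partial fractions over a field. -/
theorem partialFraction_unique {K : Type*} [Field K] {U V t s t' s' : K[X]} (hUV : IsCoprime U V)
    (hV : V ≠ 0) (hs : s.degree < V.degree) (hs' : s'.degree < V.degree)
    (h : t * V + s * U = t' * V + s' * U) : t = t' := by
  have hdvd : V ∣ s - s' := by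
    have h1 : V ∣ (s - s') * U := ⟨t' - t, by linear_combination h⟩
    exact hUV.symm.dvd_of_dvd_mul_right h1
  have h0 : s - s' = 0 :=
    eq_zero_of_dvd_of_degree_lt hdvd ((degree_sub_le _ _).trans_lt (max_lt hs hs'))
  rw [sub_eq_zero] at h0
  subst h0
  exact mul_right_cancel₀ hV (add_right_cancel h)

/-! ### Degrees of numerator and denominator -/

theorem prod_range_eq_prod_pos_mul_prod_neg {M : Type*} [CommMonoid M] (f : ℤ → M) (w : ℕ) :
    ∏ j ∈ Finset.range (w + 1), f (w - 2 * j) =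
      (∏ j ∈ Finset.range ((w + 1) / 2), f (w - 2 * j)) *
        (∏ j ∈ Finset.range ((w + 1) / 2), f (-(w - 2 * j))) * f 0 ^ ((w + 1) % 2) := by
  induction w using Nat.twoStepInduction with
  | zero => simp
  | one => simp [Finset.prod_range_succ]
  | more w ih _ =>
    have e1 : (w + 2 + 1) / 2 = (w + 1) / 2 + 1 := by omega
    have e2 : (w + 2 + 1) % 2 = (w + 1) % 2 := by omega
    have e3 : ∀ j : ℕ, ((w + 2 : ℕ) : ℤ) - 2 * ((j + 1 : ℕ) : ℤ) = w - 2 * j := fun j => by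
      push_cast; ring
    rw [e1, e2, Finset.prod_range_succ, Finset.prod_range_succ' _ (w + 1),
      Finset.prod_range_succ' _ ((w + 1) / 2), Finset.prod_range_succ' _ ((w + 1) / 2)]
    simp only [e3]
    rw [ih, ← e3]
    have e4 : ((w + 2 : ℕ) : ℤ) - 2 * ((w + 2 : ℕ) : ℤ) = -(((w + 2 : ℕ) : ℤ) - 2 * ((0 : ℕ) : ℤ)) := by
      push_cast; ring
    rw [e4]
    simp only [mul_assoc, mul_comm, mul_left_comm]

theorem sq_le_prodDegree (w : ℕ) : (w + 1) ^ 2 ≤ 4 * prodDegree w + 1 := by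
  induction w using Nat.twoStepInduction with
  | zero => simp
  | one => simp [prodDegree]
  | more w ih _ =>
    have e1 : (w + 2 + 1) / 2 = (w + 1) / 2 + 1 := by omega
    have e2 : prodDegree (w + 2) = prodDegree w + (w + 2) := by
      rw [prodDegree, e1, Finset.sum_range_succ', prodDegree]
      congr 1
      exact Finset.sum_congr rfl fun j _ => by omega
    rw [e2]
    nlinarith

/-- The numerator `(q - q⁻¹) qBinom n m` has smaller degree than the denominator. This fails for
`n = m = 0`. -/
theorem mul_add_two_le_prodDegree {n m : ℕ} (hnm : 0 < n + m) :
    n * m + 2 ≤ prodDegree (n + m + 1) := by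
  have h := sq_le_prodDegree (n + m + 1)
  have h2 : 4 * (n * m) ≤ (n + m) ^ 2 := by
    zify
    nlinarith [sq_nonneg ((n : ℤ) - m)]
  nlinarith

theorem coeff_toLaurent_natCast (f : ℤ[X]) (k : ℕ) : (toLaurent f).coeff (k : ℤ) = f.coeff k := by
  rw [LaurentPolynomial.coeff_toLaurent]
  exact Finsupp.mapDomain_apply Nat.cast_injective _ _

theorem coeff_toLaurent_of_neg (f : ℤ[X]) {j : ℤ} (hj : j < 0) : (toLaurent f).coeff j = 0 := by
  rw [LaurentPolynomial.coeff_toLaurent]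
  refine Finsupp.mapDomain_of_notMem_range _ _ ?_
  rintro ⟨k, rfl⟩
  simp at hj
  omega

/-- An antisymmetric Laurent polynomial with exponents in `(-d, d)`, times `q^d`, is a polynomial. -/
theorem exists_polynomial_of_invert_eq_neg {g : LaurentPolynomial ℤ} {d : ℕ}
    (hg : invert g = -g) (hd : ∀ j : ℤ, d ≤ j → g.coeff j = 0) :
    ∃ β : ℤ[X], toLaurent β = T d * g ∧ β.degree < ((d + d : ℕ) : WithBot ℕ) ∧
      β.reflect (d + d) = -β := by
  have hanti : ∀ j, g.coeff (-j) = -g.coeff j := fun j => by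
    rw [← LaurentPolynomial.invert_apply, hg]
    rfl
  let β : ℤ[X] := ∑ k ∈ Finset.range (d + d), monomial k (g.coeff (k - d))
  have hβ : ∀ k : ℕ, β.coeff k = g.coeff (k - d) := fun k => by
    simp only [β, finsetSum_coeff, coeff_monomial]
    rw [Finset.sum_ite_eq']
    split_ifs with h
    · rfl
    · rw [Finset.mem_range, not_lt] at h
      rw [hd _ (by omega)]
  refine ⟨β, ?_, ?_, ?_⟩
  · refine LaurentPolynomial.ext fun j => ?_
    rw [coeff_T_mul]
    rcases lt_or_ge j 0 with hj | hj
    · rw [coeff_toLaurent_of_neg _ hj, ← neg_neg (j - d), hanti, hd _ (by omega), neg_zero]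
    · obtain ⟨k, rfl⟩ := Int.eq_ofNat_of_zero_le hj
      rw [coeff_toLaurent_natCast, hβ]
  · rw [degree_lt_iff_coeff_zero]
    intro k hk
    rw [hβ, hd _ (by omega)]
  · ext k
    rw [coeff_reflect, coeff_neg, hβ, hβ]
    rcases Nat.lt_or_ge (d + d) k with hk | hk
    · rw [revAt_eq_self_of_lt hk, hd _ (by omega), neg_zero]
    · rw [revAt_le hk, ← hanti]
      congr 1
      push_cast [Nat.cast_sub hk]
      ring

/-! ### Positive parts in `q` of power series in `z` -/

/-- The coefficients of `f`, a power series in `z`, have degree at most `b` in `q`. -/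
def DegLE (b : ℤ) (f : PowerSeries (LaurentPolynomial ℤ)) : Prop :=
  ∀ (k : ℕ) (j : ℤ), b < j → (PowerSeries.coeff k f).coeff j = 0

theorem DegLE.add {b : ℤ} {f g : PowerSeries (LaurentPolynomial ℤ)} (hf : DegLE b f)
    (hg : DegLE b g) : DegLE b (f + g) := fun k j hj => by
  rw [map_add, AddMonoidAlgebra.coeff_add, Finsupp.add_apply, hf k j hj, hg k j hj, add_zero]

theorem DegLE.sum {ι : Type*} {s : Finset ι} {b : ℤ} {f : ι → PowerSeries (LaurentPolynomial ℤ)}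
    (hf : ∀ i ∈ s, DegLE b (f i)) : DegLE b (∑ i ∈ s, f i) :=
  Finset.sum_induction f (DegLE b) (fun _ _ => DegLE.add) (fun _ _ _ => by simp) hf

theorem DegLE.mul {a b : ℤ} {f g : PowerSeries (LaurentPolynomial ℤ)} (hf : DegLE a f)
    (hg : DegLE b g) : DegLE (a + b) (f * g) := fun k j hj => by
  rw [PowerSeries.coeff_mul, AddMonoidAlgebra.coeff_sum, Finsupp.finsetSum_apply]
  refine Finset.sum_eq_zero fun p _ => ?_
  rw [AddMonoidAlgebra.coeff_mul_apply_left]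
  refine Finset.sum_eq_zero fun i hi => ?_
  have hia : i ≤ a := by
    by_contra hcon
    exact (Finsupp.mem_support_iff.1 hi) (hf p.1 i (by omega))
  dsimp only
  rw [hg p.2 _ (by omega), mul_zero]

theorem DegLE.prod {ι : Type*} {s : Finset ι} {f : ι → PowerSeries (LaurentPolynomial ℤ)}
    (hf : ∀ i ∈ s, DegLE 0 (f i)) : DegLE 0 (∏ i ∈ s, f i) :=
  Finset.prod_induction f (DegLE 0) (fun _ _ h h' => by simpa using h.mul h')
    (fun k j hj => by
      rw [PowerSeries.coeff_one]
      split_ifs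
      · rw [← LaurentPolynomial.T_zero, LaurentPolynomial.T_apply, if_neg (by omega)]
      · simp) hf

theorem degLE_C_T (b : ℤ) : DegLE b (PowerSeries.C (T b)) := fun k j hj => by
  rw [PowerSeries.coeff_C]
  split_ifs
  · rw [LaurentPolynomial.T_apply, if_neg (by omega)]
  · simp

theorem degLE_X : DegLE 0 PowerSeries.X := fun k j hj => by
  rw [PowerSeries.coeff_X]
  split_ifs
  · rw [← LaurentPolynomial.T_zero, LaurentPolynomial.T_apply, if_neg (by omega)]
  · simp

/-- A polynomial in `q` and `z` as a power series in `z`. -/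
noncomputable def toSeries : ℤ[X][X] →+* PowerSeries (LaurentPolynomial ℤ) :=
  (PowerSeries.map (toLaurent : ℤ[X] →+* LaurentPolynomial ℤ)).comp
    (Polynomial.coeToPowerSeries.ringHom.comp (Bivariate.swap (R := ℤ)).toRingHom)

theorem toSeries_apply (p : ℤ[X][X]) : toSeries p =
    PowerSeries.map (toLaurent : ℤ[X] →+* LaurentPolynomial ℤ)
      ((Bivariate.swap p : ℤ[X][X]) : PowerSeries ℤ[X]) := rfl

theorem toSeries_X : toSeries X = PowerSeries.C (T 1) := by
  rw [toSeries_apply, Bivariate.swap_Y, Polynomial.coe_C, PowerSeries.map_C, toLaurent_X]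

theorem toSeries_C_X : toSeries (C X) = PowerSeries.X := by
  rw [toSeries_apply, Bivariate.swap_X, Polynomial.coe_X, PowerSeries.map_X]

theorem coeff_toSeries_C (p : ℤ[X]) (k : ℕ) :
    PowerSeries.coeff k (toSeries (C p)) = LaurentPolynomial.C (p.coeff k) := by
  rw [toSeries_apply, Bivariate.swap_C, PowerSeries.coeff_map, Polynomial.coeff_coe, coeff_map,
    toLaurent_C]

theorem degLE_toSeries_C (p : ℤ[X]) : DegLE 0 (toSeries (C p)) := fun k j hj => by
  rw [coeff_toSeries_C, LaurentPolynomial.C_apply, if_neg (by omega)]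

theorem degLE_toSeries {p : ℤ[X][X]} {d : ℕ} (hp : p.degree < d) :
    DegLE (d - 1) (toSeries p) := by
  rw [p.as_sum_support_C_mul_X_pow, map_sum]
  refine DegLE.sum fun i hi k j hj => ?_
  have hid : i < d := by exact_mod_cast (le_degree_of_mem_supp i hi).trans_lt hp
  rw [map_mul, map_pow, toSeries_X, ← map_pow, LaurentPolynomial.T_pow, mul_one]
  exact (degLE_toSeries_C _).mul (degLE_C_T i) k j (by omega)

theorem toSeries_upProd (w : ℕ) : toSeries (upProd X w) =
    ∏ j ∈ Finset.range ((w + 1) / 2),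
      (1 - PowerSeries.C (T ((w : ℤ) - 2 * j)) * PowerSeries.X) := by
  rw [upProd, map_prod]
  refine Finset.prod_congr rfl fun j hj => ?_
  rw [Finset.mem_range] at hj
  rw [map_sub, map_mul, map_pow, map_one, toSeries_X, toSeries_C_X, ← map_pow,
    LaurentPolynomial.T_pow, mul_comm, mul_one, Nat.cast_sub (by omega)]
  push_cast
  rfl

theorem toSeries_downProd (w : ℕ) : toSeries (downProd X w) =
    PowerSeries.C (T (prodDegree w)) * ∏ j ∈ Finset.range ((w + 1) / 2),
      (1 - PowerSeries.C (T (-((w : ℤ) - 2 * j))) * PowerSeries.X) := by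
  have hT : (T (prodDegree w) : LaurentPolynomial ℤ) =
      ∏ j ∈ Finset.range ((w + 1) / 2), T ((w - 2 * j : ℕ) : ℤ) := by
    rw [prodDegree]
    generalize Finset.range ((w + 1) / 2) = s
    induction s using Finset.induction_on with
    | empty => simp
    | insert j s hj ih =>
      rw [Finset.sum_insert hj, Finset.prod_insert hj, Nat.cast_add, LaurentPolynomial.T_add, ih]
  rw [hT, map_prod, ← Finset.prod_mul_distrib, downProd, map_prod]
  refine Finset.prod_congr rfl fun j hj => ?_
  rw [Finset.mem_range] at hj
  rw [map_sub, map_pow, toSeries_X, toSeries_C_X, ← map_pow, LaurentPolynomial.T_pow, mul_one,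
    mul_sub, mul_one, ← mul_assoc, ← map_mul, ← LaurentPolynomial.T_add, Nat.cast_sub (by omega)]
  push_cast
  rw [add_neg_cancel, LaurentPolynomial.T_zero, map_one, one_mul]

/-- If `v δ = u η` with `u, v ≡ 1 mod z`, `δ` free of negative powers of `q` and `η` having only negative
powers of `q`, then `δ = 0`. -/
theorem eq_zero_of_mul_eq_mul {u v η : PowerSeries (LaurentPolynomial ℤ)} {δ : PowerSeries ℤ[X]}
    (hu : PowerSeries.constantCoeff u = 1) (hv : PowerSeries.constantCoeff v = 1)
    (hη : DegLE (-1) η)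
    (h : v * PowerSeries.map (toLaurent : ℤ[X] →+* LaurentPolynomial ℤ) δ = u * η) : δ = 0 := by
  suffices H : ∀ k, PowerSeries.coeff k δ = 0 ∧ PowerSeries.coeff k η = 0 by
    ext1 k
    rw [(H k).1, map_zero]
  -- lowest coefficient of a product with a series `≡ 1 mod z`
  have low : ∀ (v f : PowerSeries (LaurentPolynomial ℤ)) (k : ℕ),
      PowerSeries.constantCoeff v = 1 → (∀ i < k, PowerSeries.coeff i f = 0) →
      PowerSeries.coeff k (v * f) = PowerSeries.coeff k f := by
    intro v f k hv hf
    rw [PowerSeries.coeff_mul, Finset.sum_eq_single (0, k)]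
    · rw [PowerSeries.coeff_zero_eq_constantCoeff_apply, hv, one_mul]
    · rintro ⟨a, b⟩ hab hne
      rw [Finset.HasAntidiagonal.mem_antidiagonal] at hab
      dsimp only at hab ⊢
      rw [hf b ?_, mul_zero]
      have : a ≠ 0 := by
        rintro rfl
        exact hne (by rw [zero_add] at hab; rw [hab])
      omega
    · intro hne
      simp at hne
  intro k
  induction k using Nat.strong_induction_on with
  | _ k ih =>
    have h1 := congrArg (PowerSeries.coeff k) h
    rw [low v _ k hv (fun i hi => by rw [PowerSeries.coeff_map, (ih i hi).1, map_zero]),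
      low u η k hu (fun i hi => (ih i hi).2), PowerSeries.coeff_map] at h1
    have h2 : PowerSeries.coeff k η = 0 := by
      refine LaurentPolynomial.ext fun j => ?_
      rcases lt_or_ge j 0 with hj | hj
      · rw [← h1, coeff_toLaurent_of_neg _ hj]
        rfl
      · exact hη k j (by omega)
    exact ⟨by rwa [h2, toLaurent_eq_zero] at h1, h2⟩

/-! ### `A_μ` as a positive part -/

theorem exists_isQIntExpansion_hook (n m h : ℕ) :
    ∃ a : ℕ →₀ ℤ, IsQIntExpansion (plethysm (hook n m) h) a :=
  exists_isQIntExpansion_of_invert_eq (invert_plethysm_hook n m h)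

/-- The series `A_μ(z, q)` with coefficients in Laurent polynomials. -/
noncomputable def laurentA (μ : YoungDiagram) : PowerSeries (LaurentPolynomial ℤ) :=
  PowerSeries.map (toLaurent : ℤ[X] →+* LaurentPolynomial ℤ) (A μ)

/-- The series `A_μ(z, q⁻¹)`. -/
noncomputable def laurentAInv (μ : YoungDiagram) : PowerSeries (LaurentPolynomial ℤ) :=
  PowerSeries.map (invert (R := ℤ)).toRingHom (laurentA μ)

theorem degLE_laurentAInv {μ : YoungDiagram}
    (hμ : ∀ h, ∃ a, IsQIntExpansion (plethysm μ h) a) : DegLE (-1) (laurentAInv μ) := by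
  intro k j hj
  have : PowerSeries.coeff k (laurentAInv μ) = invert (toLaurent (PowerSeries.coeff k (A μ))) := rfl
  rw [this, LaurentPolynomial.invert_apply]
  rcases lt_or_ge 0 j with h | h
  · exact coeff_toLaurent_of_neg _ (by omega)
  · obtain rfl : j = 0 := by omega
    rw [neg_zero]
    exact (coeff_toLaurent_natCast _ 0).trans (coeff_zero_coeff_A (hμ k))

/-- `A(z, q) - A(z, q⁻¹)` is `(q - q⁻¹) qBinom n m z^m / ∏_{j = 0}^w (1 - z q^{w - 2 j})`, where
`w = n + m + 1`. -/
theorem prod_mul_laurentA_sub (n m : ℕ) :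
    (∏ j ∈ Finset.range (n + m + 1 + 1),
      (1 - PowerSeries.C (T (((n + m + 1 : ℕ) : ℤ) - 2 * j)) * PowerSeries.X)) *
        (laurentA (hook n m) - laurentAInv (hook n m)) =
      PowerSeries.C ((T 1 - T (-1)) * qBinom n m) * PowerSeries.X ^ m := by
  have hC : laurentA (hook n m) - laurentAInv (hook n m) =
      PowerSeries.C ((T 1 - T (-1)) * qBinom n m) * PowerSeries.X ^ m *
        PowerSeries.mk (qBinom (n + m + 1)) := by
    ext1 h
    have h1 : PowerSeries.coeff h (laurentA (hook n m) - laurentAInv (hook n m)) =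
        (T 1 - T (-1)) * plethysm (hook n m) h :=
      toLaurent_coeff_A (exists_isQIntExpansion_hook n m h)
    rw [h1, mul_assoc, PowerSeries.coeff_C_mul, PowerSeries.coeff_X_pow_mul']
    split_ifs with hm
    · obtain ⟨a, rfl⟩ := Nat.exists_eq_add_of_le hm
      rw [plethysm_hook_add, PowerSeries.coeff_mk, Nat.add_sub_cancel_left]
      ring
    · rw [plethysm_hook_of_lt (not_le.1 hm), mul_zero, mul_zero]
  rw [hC, mul_left_comm, prod_mul_mk_qBinom, mul_one]

theorem constantCoeff_prod_one_sub {ι : Type*} (s : Finset ι) (f : ι → LaurentPolynomial ℤ) :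
    PowerSeries.constantCoeff (∏ j ∈ s, (1 - PowerSeries.C (f j) * PowerSeries.X)) = 1 := by
  rw [map_prod]
  refine Finset.prod_eq_one fun j _ => ?_
  simp

/-- If `ρ β = τ V + σ U`, with `β` the numerator of `A(z, q) - A(z, q⁻¹)`, then the positive part in `q`
is `A(z, q) = z^m τ / (ρ (1 - z)^ε U)`, where `ε` is one if `w = n + m + 1` is even and zero otherwise. -/
theorem toSeries_mul_A {n m : ℕ} {β : ℤ[X]} {ρ : ℤ[X]} {τ σ : ℤ[X][X]}
    (hβ : toLaurent β = T (prodDegree (n + m + 1)) * ((T 1 - T (-1)) * qBinom n m))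
    (hσ : σ.degree < prodDegree (n + m + 1))
    (h : C ρ * β.map C = τ * downProd X (n + m + 1) + σ * upProd X (n + m + 1)) :
    ((Bivariate.swap (C (ρ * (1 - X) ^ ((n + m + 1 + 1) % 2)) * upProd X (n + m + 1)) : ℤ[X][X]) :
        PowerSeries ℤ[X]) * A (hook n m) =
      ((Bivariate.swap (C (X ^ m) * τ) : ℤ[X][X]) : PowerSeries ℤ[X]) := by
  set w := n + m + 1
  set ε := (w + 1) % 2
  set v : PowerSeries (LaurentPolynomial ℤ) := ∏ j ∈ Finset.range ((w + 1) / 2),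
    (1 - PowerSeries.C (T (-((w : ℤ) - 2 * j))) * PowerSeries.X) with hv
  have hW := prod_mul_laurentA_sub n m
  rw [prod_range_eq_prod_pos_mul_prod_neg
    (fun a => 1 - PowerSeries.C (T a) * (PowerSeries.X : PowerSeries (LaurentPolynomial ℤ))) w,
    ← toSeries_upProd, ← hv, LaurentPolynomial.T_zero, map_one, one_mul] at hW
  have h' := congrArg toSeries h
  rw [map_mul, map_add, map_mul, map_mul, toSeries_downProd, ← hv] at h'
  have hβ' : toSeries (β.map C) =
      PowerSeries.C (T (prodDegree w)) * PowerSeries.C ((T 1 - T (-1)) * qBinom n m) := by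
    rw [toSeries_apply, Bivariate.swap_map_C, Polynomial.coe_C, PowerSeries.map_C, hβ, map_mul]
  have hTT : PowerSeries.C (T (-(prodDegree w : ℤ)) : LaurentPolynomial ℤ) *
      PowerSeries.C (T (prodDegree w)) = 1 := by
    rw [← map_mul, ← LaurentPolynomial.T_add, neg_add_cancel, LaurentPolynomial.T_zero, map_one]
  have hε : toSeries (C (ρ * (1 - X) ^ ε)) = toSeries (C ρ) * (1 - PowerSeries.X) ^ ε := by
    rw [C_mul, map_mul, C_pow, map_pow, C_sub, C_1, map_sub, map_one, toSeries_C_X]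
  have key := eq_zero_of_mul_eq_mul (u := toSeries (upProd X w)) (v := v)
    (η := PowerSeries.X ^ m * (PowerSeries.C (T (-(prodDegree w : ℤ))) * toSeries σ) +
      v * toSeries (C (ρ * (1 - X) ^ ε)) * laurentAInv (hook n m))
    (δ := ((Bivariate.swap (C (ρ * (1 - X) ^ ε) * upProd X w) : ℤ[X][X]) :
        PowerSeries ℤ[X]) * A (hook n m) -
      ((Bivariate.swap (C (X ^ m) * τ) : ℤ[X][X]) : PowerSeries ℤ[X]))
    (by rw [toSeries_upProd]; exact constantCoeff_prod_one_sub _ _)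
    (constantCoeff_prod_one_sub _ _) ?_ ?_
  · exact sub_eq_zero.1 key
  · have hvdeg : DegLE 0 v := DegLE.prod fun j hj => by
      rw [Finset.mem_range] at hj
      have h1 : DegLE 0 (1 : PowerSeries (LaurentPolynomial ℤ)) := by
        simpa using degLE_C_T 0
      have h2 : DegLE 0 (PowerSeries.C (T (-((w : ℤ) - 2 * j))) * PowerSeries.X) := by
        intro k i hi
        exact (degLE_C_T _).mul degLE_X k i (by omega)
      intro k i hi
      rw [map_sub, AddMonoidAlgebra.coeff_sub, Finsupp.sub_apply, h1 k i hi, h2 k i hi, sub_zero]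
    have hX : DegLE 0 ((PowerSeries.X : PowerSeries (LaurentPolynomial ℤ)) ^ m) := by
      rw [← Finset.card_range m, ← Finset.prod_const]
      exact DegLE.prod fun _ _ => degLE_X
    refine DegLE.add ?_ ?_
    · intro k i hi
      exact hX.mul ((degLE_C_T _).mul (degLE_toSeries hσ)) k i (by omega)
    · exact (hvdeg.mul (degLE_toSeries_C _)).mul
        (degLE_laurentAInv (exists_isQIntExpansion_hook n m))
  · rw [map_sub, map_mul, ← toSeries_apply, ← toSeries_apply, ← laurentA,
      map_mul toSeries _ (upProd X w), map_mul toSeries _ τ, hε, C_pow, map_pow, toSeries_C_X]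
    rw [hβ'] at h'
    linear_combination toSeries (C ρ) * hW +
      PowerSeries.X ^ m * PowerSeries.C (T (-(prodDegree w : ℤ))) * h' +
      PowerSeries.X ^ m * (v * toSeries τ - toSeries (C ρ) *
        PowerSeries.C ((T 1 - T (-1)) * qBinom n m)) * hTT

/-- The numerator of `A(z, q)` is divisible by `q`, since `A(z, 0) = 0`. -/
theorem coeff_zero_eq_zero {n m : ℕ} {D : ℤ[X][X]} {τ : ℤ[X][X]}
    (h : (D : PowerSeries ℤ[X]) * A (hook n m) =
      ((Bivariate.swap (C (X ^ m) * τ) : ℤ[X][X]) : PowerSeries ℤ[X])) : τ.coeff 0 = 0 := by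
  have h1 := congrArg (PowerSeries.map (constantCoeff (R := ℤ))) h
  have hA : PowerSeries.map (constantCoeff (R := ℤ)) (A (hook n m)) = 0 := by
    ext1 k
    rw [PowerSeries.coeff_map, map_zero]
    exact coeff_zero_coeff_A (exists_isQIntExpansion_hook n m k)
  rw [map_mul, hA, mul_zero] at h1
  have h2 : (Bivariate.swap (C (X ^ m) * τ)).map (constantCoeff (R := ℤ)) = 0 := by
    ext k
    have := congrArg (PowerSeries.coeff k) h1
    rw [PowerSeries.coeff_map, Polynomial.coeff_coe] at this
    rw [coeff_map, ← this]
    simp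
  have h3 : (mapRingHom (constantCoeff (R := ℤ))).comp (Bivariate.swap (R := ℤ)).toRingHom =
      constantCoeff (R := ℤ[X]) := by
    apply Polynomial.ringHom_ext
    · intro a
      change (Bivariate.swap (C a)).map _ = _
      rw [Bivariate.swap_C, Polynomial.map_map]
      ext k
      simp
    · change (Bivariate.swap X).map _ = _
      rw [Bivariate.swap_Y]
      simp
  have h4 : (C (X ^ m) * τ).coeff 0 = 0 := (RingHom.congr_fun h3 (C (X ^ m) * τ)).symm.trans h2
  rw [coeff_C_mul] at h4
  exact (mul_eq_zero.1 h4).resolve_left (pow_ne_zero _ X_ne_zero)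

/-! ### Reciprocity -/

/-- `τ / U` and `σ / V` are the parts of a proper fraction `β / (U V)` with poles at `q^a = z⁻¹` and at
`q^a = z`. The substitution `(z, q) ↦ (z⁻¹, q⁻¹)` respects the two types of poles, so uniqueness
of the decomposition turns the antisymmetry of `β` into one of `τ`. -/
theorem reflect_map_partialFraction {K : Type*} [Field K] (ι : K →+* K) {z : K} (hz : z ≠ 0)
    (hι : ι z = z⁻¹) {w : ℕ} (hUV : IsCoprime (upProd z w) (downProd z w)) {β τ σ : K[X]}
    (hβ : β.map ι = β) (hβ' : β.reflect (prodDegree w + prodDegree w) = -β)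
    (hτ : τ.degree < prodDegree w) (hσ : σ.degree < prodDegree w) (hσ0 : σ.coeff 0 = 0)
    (h : β = τ * downProd z w + σ * upProd z w) :
    (τ.map ι).reflect (prodDegree w) = C (-(-z) ^ ((w + 1) / 2)) * τ := by
  set d := prodDegree w
  set c := (-z⁻¹) ^ ((w + 1) / 2) with hc
  have hcz : c * (-z) ^ ((w + 1) / 2) = 1 := by
    rw [hc, ← mul_pow, neg_mul_neg, inv_mul_cancel₀ hz, one_pow]
  have h1 := congrArg (fun p => (p.map ι).reflect (d + d)) h
  simp only [hβ, hβ', Polynomial.map_add, Polynomial.map_mul, reflect_add] at h1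
  rw [map_upProd, map_downProd, hι,
    reflect_mul _ _ (natDegree_map_le.trans (natDegree_le_of_degree_le hτ.le))
      (natDegree_downProd _ _).le,
    reflect_mul _ _ (natDegree_map_le.trans (natDegree_le_of_degree_le hσ.le))
      (natDegree_upProd_le _ _), reflect_upProd, reflect_downProd, upProd_inv hz, downProd_inv hz,
    ← hc, h] at h1
  have hcC : (C c * C ((-z) ^ ((w + 1) / 2)) : K[X]) = 1 := by rw [← C_mul, hcz, C_1]
  refine partialFraction_unique hUV (monic_downProd z w).ne_zero
    (s := (σ.map ι).reflect d) (s' := C (-(-z) ^ ((w + 1) / 2)) * σ) ?_ ?_ ?_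
  · rw [degree_downProd, degree_lt_iff_coeff_zero]
    intro k hk
    rw [coeff_reflect]
    rcases hk.eq_or_lt with rfl | hk
    · rw [revAt_le le_rfl, Nat.sub_self, coeff_map, hσ0, map_zero]
    · rw [revAt_eq_self_of_lt hk, coeff_map, coeff_eq_zero_of_degree_lt, map_zero]
      exact hσ.trans (by exact_mod_cast hk)
  · rw [degree_downProd]
    refine (degree_mul_le _ _).trans_lt (lt_of_le_of_lt ?_ hσ)
    exact (add_le_add_left degree_C_le _).trans (by rw [zero_add])
  · rw [C_neg]
    linear_combination (-C ((-z) ^ ((w + 1) / 2))) * h1 -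
      ((τ.map ι).reflect d * downProd z w + (σ.map ι).reflect d * upProd z w) * hcC

/-! ### Rational functions -/

theorem represents_unique {F : PowerSeries ℤ[X]} {r r' : RatFun} (h : Represents r F)
    (h' : Represents r' F) : r = r' := by
  obtain ⟨P, D, hD, hF, rfl⟩ := h
  obtain ⟨P', D', hD', hF', rfl⟩ := h'
  have hinj : Function.Injective (algebraMap ℤ[X][X] RatFun) := IsFractionRing.injective _ _
  have h1 : P * D' = P' * D := by
    apply Polynomial.coe_injective
    rw [Polynomial.coe_mul, Polynomial.coe_mul, ← hF, ← hF']
    ring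
  rw [div_eq_div_iff ((map_ne_zero_iff _ hinj).2 hD) ((map_ne_zero_iff _ hinj).2 hD'), ← map_mul,
    ← map_mul, h1]

theorem qVar_ne_zero : qVar ≠ 0 := by
  have hinj : Function.Injective (algebraMap ℤ[X][X] RatFun) := IsFractionRing.injective _ _
  rw [qVar, Ne, map_eq_zero_iff _ hinj, C_eq_zero]
  exact X_ne_zero

theorem zVar_ne_zero : zVar ≠ 0 := by
  have hinj : Function.Injective (algebraMap ℤ[X][X] RatFun) := IsFractionRing.injective _ _
  rw [zVar, Ne, map_eq_zero_iff _ hinj]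
  exact X_ne_zero

theorem invVars_qVar : invVars qVar = qVar⁻¹ := by
  rw [qVar, invVars, IsFractionRing.lift_algebraMap, invVarsPoly]
  simp [qVar]

theorem invVars_zVar : invVars zVar = zVar⁻¹ := by
  rw [zVar, invVars, IsFractionRing.lift_algebraMap, invVarsPoly]
  simp [zVar]

/-- The inclusion of `ℤ[z]` in the field of rational functions. -/
noncomputable def ratFunOfZ : ℤ[X] →+* RatFun := eval₂RingHom (Int.castRingHom RatFun) zVar

theorem ratFunOfZ_X : ratFunOfZ X = zVar := by simp [ratFunOfZ]

theorem algebraMap_swap (p : ℤ[X][X]) :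
    algebraMap ℤ[X][X] RatFun (Bivariate.swap p) = (p.map ratFunOfZ).eval qVar := by
  have h : (algebraMap ℤ[X][X] RatFun).comp (Bivariate.swap (R := ℤ)).toRingHom =
      (evalRingHom qVar).comp (mapRingHom ratFunOfZ) := by
    apply Polynomial.ringHom_ext'
    · apply Polynomial.ringHom_ext
      · intro a
        simp
      · change algebraMap ℤ[X][X] RatFun (Bivariate.swap (C X)) = _
        rw [Bivariate.swap_X]
        simp [ratFunOfZ_X, zVar]
    · change algebraMap ℤ[X][X] RatFun (Bivariate.swap X) = _
      rw [Bivariate.swap_Y]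
      simp [qVar]
  exact RingHom.congr_fun h p

theorem ratFunOfZ_injective : Function.Injective ratFunOfZ := by
  have hinj : Function.Injective (algebraMap ℤ[X][X] RatFun) := IsFractionRing.injective _ _
  intro a b hab
  have h : algebraMap ℤ[X][X] RatFun (Bivariate.swap (C a)) =
      algebraMap ℤ[X][X] RatFun (Bivariate.swap (C b)) := by
    rw [algebraMap_swap, algebraMap_swap, map_C, map_C, hab]
  exact C_injective (Bivariate.swap.injective (hinj h))

theorem invVars_eval (p : RatFun[X]) : invVars (p.eval qVar) = (p.map invVars).eval qVar⁻¹ := by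
  rw [← invVars_qVar, eval_map_apply]

theorem eval_inv_eq {K : Type*} [Field K] {q : K} (hq : q ≠ 0) {f : K[X]} {d : ℕ}
    (hf : f.natDegree ≤ d) : f.eval q⁻¹ = (f.reflect d).eval q * (q ^ d)⁻¹ := by
  let := invertibleOfNonzero (inv_ne_zero hq)
  have h := eval₂_reflect_mul_pow (RingHom.id K) q⁻¹ d f hf
  rw [invOf_eq_inv, inv_inv, inv_pow] at h
  exact h.symm

theorem coeff_zero_upProd {K : Type*} [CommRing K] (z : K) (w : ℕ) :
    (upProd z w).coeff 0 = 1 := by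
  rw [upProd, coeff_zero_prod]
  refine Finset.prod_eq_one fun j hj => ?_
  rw [Finset.mem_range] at hj
  have : w - 2 * j ≠ 0 := by omega
  simp [coeff_X_pow, this.symm]

theorem isCoprime_upProd_downProd_zVar (w : ℕ) :
    IsCoprime (upProd zVar w) (downProd zVar w) := by
  obtain ⟨ρ, h0, a, b, hab⟩ := coprimeInQ_upProd_downProd w
  have hρ : ratFunOfZ ρ ≠ 0 := by
    rw [map_ne_zero_iff _ ratFunOfZ_injective]
    rintro rfl
    simp at h0
  have h := congrArg (Polynomial.map ratFunOfZ) hab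
  rw [Polynomial.map_add, Polynomial.map_mul, Polynomial.map_mul, map_upProd, map_downProd, map_C,
    ratFunOfZ_X] at h
  have h1 : (C (ratFunOfZ ρ)⁻¹ * C (ratFunOfZ ρ) : RatFun[X]) = 1 := by
    rw [← C_mul, inv_mul_cancel₀ hρ, C_1]
  refine ⟨C (ratFunOfZ ρ)⁻¹ * a.map ratFunOfZ, C (ratFunOfZ ρ)⁻¹ * b.map ratFunOfZ, ?_⟩
  linear_combination C (ratFunOfZ ρ)⁻¹ * h + h1

/-- The numerator of `A(z, q) - A(z, q⁻¹)` over the denominator `U V (1 - z)^ε`, up to `z^m`. -/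
theorem exists_numerator {n m : ℕ} (hnm : 0 < n + m) :
    ∃ β : ℤ[X], toLaurent β = T (prodDegree (n + m + 1)) * ((T 1 - T (-1)) * qBinom n m) ∧
      β.degree < ((prodDegree (n + m + 1) + prodDegree (n + m + 1) : ℕ) : WithBot ℕ) ∧
      β.reflect (prodDegree (n + m + 1) + prodDegree (n + m + 1)) = -β := by
  apply exists_polynomial_of_invert_eq_neg
  · rw [map_mul, invert_qBinom, map_sub, LaurentPolynomial.invert_T, LaurentPolynomial.invert_T,
      neg_neg]
    ring
  · intro j hj
    have hle : (n * m + 2 : ℤ) ≤ prodDegree (n + m + 1) := by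
      exact_mod_cast mul_add_two_le_prodDegree hnm
    rw [sub_mul, AddMonoidAlgebra.coeff_sub, Finsupp.sub_apply, coeff_T_mul, coeff_T_mul,
      coeff_qBinom_eq_zero (by linarith), coeff_qBinom_eq_zero (by linarith), sub_zero]

theorem exists_represents_invVars_eq {n m : ℕ} (hnm : 0 < n + m) :
    ∃ r : RatFun, Represents r (A (hook n m)) ∧
      invVars r = (-1) ^ (n + m + 1) * zVar ^ ((n : ℤ) - m + 2) * r := by
  have hinj : Function.Injective (algebraMap ℤ[X][X] RatFun) := IsFractionRing.injective _ _
  set w := n + m + 1 with hw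
  set d := prodDegree w with hd
  set ε := (w + 1) % 2 with hε
  set k := (w + 1) / 2 with hk
  -- the numerator of `A(z, q) - A(z, q⁻¹)` and its partial fractions
  obtain ⟨β, hβ, hβdeg, hβrefl⟩ := exists_numerator hnm
  obtain ⟨ρ, τ, σ, hρ0, hτ, hσ, h⟩ := exists_partialFraction w (β := β.map C)
    (degree_map_le.trans_lt hβdeg)
  have hser := toSeries_mul_A hβ hσ h
  have hτ0 : τ.coeff 0 = 0 := coeff_zero_eq_zero hser
  have hβ0 : β.coeff 0 = 0 := by
    have h1 := congrArg (fun p => p.coeff 0) hβrefl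
    simp only [coeff_reflect, revAt_zero, coeff_neg] at h1
    rw [coeff_eq_zero_of_degree_lt hβdeg] at h1
    omega
  have hσ0 : σ.coeff 0 = 0 := by
    have h1 := congrArg (fun p => p.coeff 0) h
    simp only [coeff_add, mul_coeff_zero, coeff_map, hβ0, hτ0, coeff_zero_upProd] at h1
    simpa using h1.symm
  -- the decomposition over the field of rational functions, normalized to `ρ = 1`
  have hρne : ρ ≠ 0 := by
    rintro rfl
    simp at hρ0
  have hρ : ratFunOfZ ρ ≠ 0 := (map_ne_zero_iff _ ratFunOfZ_injective).2 hρne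
  set τ' : RatFun[X] := C (ratFunOfZ ρ)⁻¹ * τ.map ratFunOfZ with hτ'
  set σ' : RatFun[X] := C (ratFunOfZ ρ)⁻¹ * σ.map ratFunOfZ with hσ'
  have hdeg : ∀ p : ℤ[X][X], p.degree < d →
      (C (ratFunOfZ ρ)⁻¹ * p.map ratFunOfZ).degree < d := fun p hp => by
    rw [degree_C_mul (inv_ne_zero hρ)]
    exact degree_map_le.trans_lt hp
  have hβmap : (β.map C).map ratFunOfZ = β.map (Int.castRingHom RatFun) := by
    rw [Polynomial.map_map]
    congr 1
    exact RingHom.ext_int _ _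
  have hdec : β.map (Int.castRingHom RatFun) = τ' * downProd zVar w + σ' * upProd zVar w := by
    have h1 := congrArg (Polynomial.map ratFunOfZ) h
    rw [Polynomial.map_mul, Polynomial.map_add, Polynomial.map_mul, Polynomial.map_mul, map_upProd,
      map_downProd, map_C, ratFunOfZ_X, hβmap] at h1
    have h2 : (C (ratFunOfZ ρ)⁻¹ * C (ratFunOfZ ρ) : RatFun[X]) = 1 := by
      rw [← C_mul, inv_mul_cancel₀ hρ, C_1]
    linear_combination C (ratFunOfZ ρ)⁻¹ * h1 - β.map (Int.castRingHom RatFun) * h2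
  have hrefl := reflect_map_partialFraction invVars zVar_ne_zero invVars_zVar
    (isCoprime_upProd_downProd_zVar w) (β := β.map (Int.castRingHom RatFun)) (τ := τ') (σ := σ')
    (by rw [Polynomial.map_map]; congr 1; exact RingHom.ext_int _ _)
    (by rw [reflect_map, hβrefl, Polynomial.map_neg]) (hdeg τ hτ) (hdeg σ hσ)
    (by rw [hσ', coeff_C_mul, coeff_map, hσ0, map_zero, mul_zero]) hdec
  -- evaluation at `q`
  set a := τ'.eval qVar with ha
  set u := (upProd zVar w).eval qVar with hu
  set b := (1 - zVar) ^ ε with hb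
  have hain : invVars a = -(-zVar) ^ k * a * (qVar ^ d)⁻¹ := by
    rw [ha, invVars_eval, eval_inv_eq qVar_ne_zero
      (natDegree_map_le.trans (natDegree_le_of_degree_le (hdeg τ hτ).le)), hrefl, eval_mul, eval_C]
  have huin : invVars u = ((-zVar) ^ k)⁻¹ * u * (qVar ^ d)⁻¹ := by
    rw [hu, invVars_eval, map_upProd, invVars_zVar,
      eval_inv_eq qVar_ne_zero (natDegree_upProd_le _ _), reflect_upProd, downProd_inv zVar_ne_zero,
      eval_mul, eval_C, neg_inv, inv_pow]
  have hbin : invVars b = ((-zVar) ^ ε)⁻¹ * b := by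
    rw [hb, map_pow, map_sub, map_one, invVars_zVar, ← inv_pow, ← mul_pow]
    congr 1
    have hz := zVar_ne_zero
    field_simp
    ring
  have hD0 : C (ρ * (1 - X) ^ ε) * upProd X w ≠ 0 := by
    refine mul_ne_zero (C_ne_zero.2 (mul_ne_zero hρne (pow_ne_zero _ ?_))) ?_
    · intro h1
      have := congrArg (fun p : ℤ[X] => p.coeff 0) h1
      simp at this
    · intro h1
      have := coeff_zero_upProd (X : ℤ[X]) w
      rw [h1] at this
      simp at this
  have hD : Bivariate.swap (C (ρ * (1 - X) ^ ε) * upProd X w) ≠ 0 :=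
    (map_ne_zero_iff _ Bivariate.swap.injective).2 hD0
  have hDval : algebraMap ℤ[X][X] RatFun (Bivariate.swap (C (ρ * (1 - X) ^ ε) * upProd X w)) =
      ratFunOfZ ρ * b * u := by
    rw [algebraMap_swap, Polynomial.map_mul, map_upProd, map_C, ratFunOfZ_X, eval_mul, eval_C,
      map_mul, map_pow, map_sub, map_one, ratFunOfZ_X]
  have hPval : algebraMap ℤ[X][X] RatFun (Bivariate.swap (C (X ^ m) * τ)) =
      zVar ^ m * (ratFunOfZ ρ * a) := by
    rw [algebraMap_swap, Polynomial.map_mul, map_C, map_pow, ratFunOfZ_X, eval_mul, eval_C, ha, hτ',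
      eval_mul, eval_C, mul_inv_cancel_left₀ hρ]
  have hbu : ratFunOfZ ρ * b * u ≠ 0 := by
    rw [← hDval]
    exact (map_ne_zero_iff _ hinj).2 hD
  have hb0 : b ≠ 0 := right_ne_zero_of_mul (left_ne_zero_of_mul hbu)
  have hu0 : u ≠ 0 := right_ne_zero_of_mul hbu
  have hr : zVar ^ m * (ratFunOfZ ρ * a) / (ratFunOfZ ρ * b * u) = zVar ^ m * a / (b * u) := by
    field_simp
  refine ⟨_, ⟨_, _, hD, hser, rfl⟩, ?_⟩
  rw [hDval, hPval, hr]
  have hz := zVar_ne_zero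
  have hq : qVar ^ d ≠ 0 := pow_ne_zero _ qVar_ne_zero
  have hZ : (-zVar) ^ k ≠ 0 := pow_ne_zero _ (neg_ne_zero.2 hz)
  have hE : (-zVar) ^ ε ≠ 0 := pow_ne_zero _ (neg_ne_zero.2 hz)
  -- `2 k + ε` is the number `w + 1` of factors of the denominator
  have hcount : (-zVar) ^ k * (-zVar) ^ k * (-zVar) ^ ε = (-1) ^ (w + 1) * zVar ^ (n + m + 2) := by
    rw [← pow_add, ← pow_add, neg_pow, show k + k + ε = n + m + 2 by omega]
  have hzpow : zVar ^ ((n : ℤ) - m + 2) * zVar ^ m = zVar ^ (n + 2) := by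
    rw [← zpow_natCast zVar m, ← zpow_natCast zVar (n + 2), ← zpow_add₀ hz]
    congr 1
    push_cast
    ring
  have hinv : invVars (zVar ^ m * a / (b * u)) =
      -((-zVar) ^ k * (-zVar) ^ k * (-zVar) ^ ε) * (zVar ^ m)⁻¹ * (a / (b * u)) := by
    rw [map_div₀, map_mul, map_mul, map_pow, invVars_zVar, hain, huin, hbin, inv_pow]
    generalize (-zVar) ^ k = Z at hZ ⊢
    generalize (-zVar) ^ ε = E at hE ⊢
    generalize qVar ^ d = Q at hq ⊢
    field_simp
  rw [hinv, hcount, mul_div_assoc]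
  have h3 : zVar ^ (n + m + 2) * (zVar ^ m)⁻¹ = zVar ^ (n + 2) := by
    rw [show n + m + 2 = n + 2 + m by ring, pow_add, mul_inv_cancel_right₀ (pow_ne_zero _ hz)]
  rw [pow_succ (-1 : RatFun) w]
  linear_combination (-1) ^ w * (a / (b * u)) * (h3 - hzpow)

end SL2Plethysm

theorem mainTheorem8 (n m : ℕ) (hnm : 0 < n + m) :
    (∀ h : ℕ, ∃ a : ℕ →₀ ℤ, IsQIntExpansion (plethysm (hook n m) h) a) ∧
    (∃! r : RatFun, Represents r (A (hook n m))) ∧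
    ∀ r : RatFun, Represents r (A (hook n m)) →
      invVars r = (-1) ^ (hook n m).card * zVar ^ ((n : ℤ) - m + 2) * r := by
  obtain ⟨r, hr, hinv⟩ := exists_represents_invVars_eq hnm
  refine ⟨exists_isQIntExpansion_hook n m, ⟨r, hr, fun _ h => represents_unique h hr⟩, ?_⟩
  intro r' hr'
  rw [represents_unique hr' hr, card_hook, hinv]
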